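/- Let $q$ and $k$ be positive integers, $n=qk$. The regular repeat-accumulate code RA($q$) with interleaver $\pi$ (a permutation of $n$ positions) repeats each of $k$ information bits $q$ times, permutes the resulting $n$ bits by $\pi$, and accumulates modulo 2: $c_i=w_1+\dots+w_i \bmod 2$, where $w$ is the permuted block. Let $X_t\subseteq\{1,\dots,n\}$ be the set of the $q$ positions of $w$ that hold copies of information bit $t$. The codeword $c$ is sent over the binary-input AWGN channel: the received vector is $\tilde y_i=(1-2c_i)+z_i$ with $z_1,\dots,z_n$ independent $\mathcal N(0,\sigma^2)$. Let $\gamma_i$ be the log-likelihood ratio of bit value $0$ against $1$ given $\tilde y_i$. The accumulator trellis has nodes $s_j^a$ ($0\le j\le n$, $a\in\{0,1\}$) and edges $s_{i-1}^a\to s_i^b$ ($1\le i\le n$); such an edge costs $\gamma_i$ if $b=1$ and $0$ if $b=0$, and is an input-1 edge if $a\ne b$. The linear program RALP minimizes the total cost $\sum_e \gamma_e f_e$ over all $f$ and $x\in\mathbb R^k$ with $0\le f_e\le 1$, total flow $1$ out of $s_0^0$, flow conservation at every node other than $s_0^0$ and $s_n^0$, and, for every $t$ and every $i\in X_t$, total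 flow $x_t$ on the two input-1 edges of layer $i$. The RALP decoder takes an optimum point $(f^*,x^*)$ of RALP (with any rule for breaking ties), outputs $x^*$ if $f^*$ is integral, and outputs "error" otherwise. Its word error probability (WEP) for a given transmitted information word is the probability that its output is not that word. The auxiliary graph has vertices $g_1,\dots,g_n$, the edges $\{g_i,g_{i+1}\}$, $1\le i<n$, and the hyperedges $\{g_i: i\in X_t\}$, $1\le t\le k$. A path of length $m$ is a sequence of $m+1$ vertices in which consecutive (distinct) vertices are joined by an edge or hyperedge, with no edge or hyperedge used twice in a row; a cycle is a path of length at least $1$ that ends where it begins; the girth is the length of a shortest cycle. Then: (a) For every even $q\ge 3$ and every $k$ with $n=qk\ge q^4$, there is an interleaver whose auxiliary graph has girth at least $\lfloor\log_q n\rfloor-1$. (b) For every $\sigma>0$ there is a constant $\tilde K>0$ such that the following holds for every even $q\ge 2$, every $k$ with $n=qk\ge q^4$, and every $\epsilon>0$. If $$\frac1{\sigma^2}>4\ln q\left(1+\epsilon+\tfrac12\log_q(2q-1)\right),$$ then for every interleaver as in (a) (that is, with auxiliary graph of girth at least $\lfloor\log_q n\rfloor-1$), and for every transmitted information word, the word error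 probability of the RALP decoder satisfies $$\mathrm{WEP}<\tilde K\,\sqrt{\frac{1}{\log_q n-1}}\;n^{-\epsilon}.$$ -/

import Mathlib

open MeasureTheory ProbabilityTheory

noncomputable section

namespace RepeatAccumulate

/-! ### The encoder of a regular RA(`q`) code with `k` information bits

The block length is `n = k * q`.  Positions and layers are numbered from `0`. -/

/-- An interleaver of the block of `k * q` repeated bits. -/
abbrev Interleaver (k q : ℕ) : Type := Equiv.Perm (Fin (k * q))

variable {k q : ℕ}

/-- The `q`-fold repetition code: every bit is repeated `q` times in a row. -/
def repetition (u : Fin k → ZMod 2) (j : Fin (k * q)) : ZMod 2 := u j.divNat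

/-- The accumulator: its output at time `i` is the mod-2 sum of the inputs up to time `i`. -/
def accumulate {n : ℕ} (w : Fin n → ZMod 2) (i : Fin n) : ZMod 2 := ∑ j ∈ Finset.Iic i, w j

/-- Repetition, interleaving, accumulation. -/
def encode (π : Interleaver k q) (u : Fin k → ZMod 2) : Fin (k * q) → ZMod 2 :=
  accumulate fun i => repetition u (π i)

/-- The index set `X_t`: the times at which the accumulator is fed with a copy of the
information bit `t`. -/
def copies (π : Interleaver k q) (t : Fin k) : Finset (Fin (k * q)) :=
  Finset.univ.filter fun i => (π i).divNat = t

/-! ### The binary-input AWGN channel with noise variance `σ ^ 2` -/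

/-- The modulation: bit `0` is sent as `+1` and bit `1` as `-1`. -/
def modulate (b : ZMod 2) : ℝ := 1 - 2 * (b.val : ℝ)

/-- The law of the received vector when `c` is transmitted: independent coordinates, the `i`-th
one being the modulation of `c i` plus a centred Gaussian of variance `σ ^ 2`. -/
def awgnOutput {n : ℕ} (σ : ℝ) (c : Fin n → ZMod 2) : Measure (Fin n → ℝ) :=
  Measure.pi fun i => gaussianReal (modulate (c i)) (σ ^ 2).toNNReal

/-- The log-likelihood ratio of a received symbol `y`. -/
def awgnLLR (σ : ℝ) (y : ℝ) : ℝ :=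
  Real.log (gaussianPDFReal (modulate 0) (σ ^ 2).toNNReal y /
    gaussianPDFReal (modulate 1) (σ ^ 2).toNNReal y)

/-! ### The trellis of the accumulator -/

/-- The node `(j, s)` is the state `s` at time `j`. -/
abbrev TrellisNode (n : ℕ) : Type := Fin (n + 1) × ZMod 2

/-- The edge `(i, a, b)` of layer `i` goes from the state `a` at time `i` to the state `b` at
time `i + 1`. -/
abbrev TrellisEdge (n : ℕ) : Type := Fin n × ZMod 2 × ZMod 2

def source {n : ℕ} (e : TrellisEdge n) : TrellisNode n := (e.1.castSucc, e.2.1)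

def target {n : ℕ} (e : TrellisEdge n) : TrellisNode n := (e.1.succ, e.2.2)

/-- The total flow on the edges that exit the node `v`. -/
def outFlow {n : ℕ} (f : TrellisEdge n → ℝ) (v : TrellisNode n) : ℝ :=
  ∑ e with source e = v, f e

/-- The total flow on the edges that enter the node `v`. -/
def inFlow {n : ℕ} (f : TrellisEdge n → ℝ) (v : TrellisNode n) : ℝ :=
  ∑ e with target e = v, f e

/-- The two "input-1" edges of layer `i`, i.e. those that change the state. -/
def inputOneEdges {n : ℕ} (i : Fin n) : Finset (TrellisEdge n) := {(i, 0, 1), (i, 1, 0)}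

/-- The cost of an edge of layer `i`: it is `γ i` if the edge is labelled with the output bit `1`
and `0` if it is labelled with `0`.  The output of the accumulator is its new state. -/
def edgeCost {n : ℕ} (γ : Fin n → ℝ) (e : TrellisEdge n) : ℝ := if e.2.2 = 1 then γ e.1 else 0

/-! ### The linear program RALP and the RALP decoder -/

/-- A pair `(f, x)` of a flow on the trellis and a fractional information word. -/
abbrev RALPPoint (k q : ℕ) : Type := (TrellisEdge (k * q) → ℝ) × (Fin k → ℝ)

/-- The constraints of RALP. -/
structure IsFeasible (π : Interleaver k q) (P : RALPPoint k q) : Prop where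
  unit_flow : outFlow P.1 (0, 0) = 1
  conservation : ∀ v : TrellisNode (k * q), v ≠ (0, 0) → v ≠ (Fin.last (k * q), 0) →
    outFlow P.1 v = inFlow P.1 v
  agreeability : ∀ t : Fin k, ∀ i ∈ copies π t, P.2 t = ∑ e ∈ inputOneEdges i, P.1 e
  nonneg : ∀ e, 0 ≤ P.1 e
  le_one : ∀ e, P.1 e ≤ 1

/-- The objective function of RALP. -/
def objective (γ : Fin (k * q) → ℝ) (P : RALPPoint k q) : ℝ := ∑ e, edgeCost γ e * P.1 e

/-- The optimum points of RALP for the log-likelihood ratios `γ`. -/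
def IsOptimal (π : Interleaver k q) (γ : Fin (k * q) → ℝ) (P : RALPPoint k q) : Prop :=
  IsFeasible π P ∧ ∀ Q : RALPPoint k q, IsFeasible π Q → objective γ P ≤ objective γ Q

/-- `solve` assigns to every received vector some optimum point of RALP (any rule may be used to
select one where there are several). -/
def SolvesRALP (σ : ℝ) (π : Interleaver k q) (solve : (Fin (k * q) → ℝ) → RALPPoint k q) : Prop :=
  ∀ y, IsOptimal π (fun i => awgnLLR σ (y i)) (solve y)

open Classical in
/-- The output of the RALP decoder at an optimum point `(f, x)`: the word `x` if `f` is integral,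
and "error" (`none`) if it is not. -/
def decoderOutput (P : RALPPoint k q) : Option (Fin k → ℝ) :=
  if ∀ e, P.1 e = 0 ∨ P.1 e = 1 then some P.2 else none

/-- The probability that the decoder does not output the information word `u`, when the codeword
of `u` is transmitted over the AWGN channel. -/
def wordErrorProb (σ : ℝ) (π : Interleaver k q) (solve : (Fin (k * q) → ℝ) → RALPPoint k q)
    (u : Fin k → ZMod 2) : ℝ :=
  (awgnOutput σ (encode π u)).real
    {y | decoderOutput (solve y) ≠ some fun t => ((u t).val : ℝ)}

/-! ### The auxiliary graph and its girth -/

/-- The Hamiltonian edges (`Sum.inl i` joins the vertices `i` and `i + 1`) and the matching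
hyperedges (`Sum.inr t` joins the vertices in `copies π t`). -/
abbrev AuxEdge (k q : ℕ) : Type := Fin (k * q) ⊕ Fin k

/-- The (hyper)edge `e` connects the two distinct vertices `a` and `b`. -/
def Connects (π : Interleaver k q) (e : AuxEdge k q) (a b : Fin (k * q)) : Prop :=
  match e with
  | Sum.inl i => (a = i ∧ b.val = i.val + 1) ∨ (b = i ∧ a.val = i.val + 1)
  | Sum.inr t => a ∈ copies π t ∧ b ∈ copies π t ∧ a ≠ b

/-- `p 0, …, p m` is a path of length `m` in the auxiliary graph that travels along the
(hyper)edges `e 0, …, e (m - 1)`, no (hyper)edge being used twice in a row. -/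
def IsPath (π : Interleaver k q) (m : ℕ) (p : ℕ → Fin (k * q)) (e : ℕ → AuxEdge k q) : Prop :=
  (∀ j < m, Connects π (e j) (p j) (p (j + 1))) ∧ ∀ j, j + 1 < m → e j ≠ e (j + 1)

/-- There is a cycle of length `m`, i.e. a path of length `m ≥ 1` that ends where it begins. -/
def HasCycle (π : Interleaver k q) (m : ℕ) : Prop :=
  1 ≤ m ∧ ∃ p e, IsPath π m p e ∧ p m = p 0

/-- The length of a shortest cycle of the auxiliary graph (`⊤` if there is none). -/
def girth (π : Interleaver k q) : ℕ∞ := ⨅ (m : ℕ) (_ : HasCycle π m), (m : ℕ∞)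

end RepeatAccumulate

end

open RepeatAccumulate

/-! Existence of interleavers is an exchange argument. Up to the order inside the blocks, an
interleaver is a labelling of a Hamiltonian path by `k` labels, each used `q` times. Vertices are
labelled one by one with the girth condition kept. Given an unlabelled `v` and a label `T` that is
not used up, `v` may be too close to `T`, but the ball of radius `g - 1` about `v` and that of
radius `g - 2` about the class of `T` do not cover all `n ≥ q ^ g` vertices
(`two_mul_card_ball_le`). A vertex `w` outside both takes `T` (`LargeGirth.update`); if `w` already
had a label, `v` inherits it (`LargeGirth.swap`).

For the error bound, an optimal flow is compared with the path of the transmitted codeword. Since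
`q` is even, this path ends in state 0, so the layers can be closed up to a cycle. The flow through
wrong states is a weight on the Hamiltonian edges; at each layer part of it passes straight on, and
the rest turns into the hyperedge, in an amount that depends only on the information bit. Spreading
the hyperedge flow evenly over the other `q - 1` copies gives a reversible random walk on directed
edges whose stationary weight is the wrong flow. Its mean cost is the objective minus that of the
codeword, hence nonpositive, so by averaging there are walks of every length with nonpositive cost
(`exists_walk_of_flow`).

A walk along `h + 1` Hamiltonian edges with `2 (h + 1) ≤ g` repeats no edge
(`nodup_edges_of_chain`). Its cost is thus a positive multiple of a Gaussian of mean `h + 1` and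
variance `(h + 1) σ ^ 2`. There are at most `2 n (2 q - 1) ^ h` such walks; a union bound with `h`
about half of `log_q n` gives the result (`wordErrorProb_le`, `union_bound_lt`). -/

namespace RepeatAccumulate

/-! ### Bounded walks -/

/-- There is a walk of length at most `r` from the second to the third argument. -/
inductive Within {V : Type*} (adj : V → V → Prop) : ℕ → V → V → Prop
  | refl (r : ℕ) (a : V) : Within adj r a a
  | cons {r : ℕ} {a b c : V} : adj a b → Within adj r b c → Within adj (r + 1) a c

namespace Within

variable {V : Type*} {adj adj' : V → V → Prop}

theorem mono {r s : ℕ} {a b : V} (h : Within adj r a b) (hrs : r ≤ s) : Within adj s a b := by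
  induction h generalizing s with
  | refl => exact refl _ _
  | cons hab _ ih =>
    obtain ⟨s, rfl⟩ : ∃ s', s = s' + 1 := ⟨s - 1, by omega⟩
    exact cons hab (ih (by omega))

theorem mono_adj {r : ℕ} {a b : V} (hadj : ∀ x y, adj x y → adj' x y) (h : Within adj r a b) :
    Within adj' r a b := by
  induction h with
  | refl => exact refl _ _
  | cons hab _ ih => exact cons (hadj _ _ hab) ih

theorem trans {r s : ℕ} {a b c : V} (h : Within adj r a b) (h' : Within adj s b c) :
    Within adj (r + s) a c := by
  induction h with
  | refl => exact h'.mono (by omega)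
  | cons hab _ ih => exact (cons hab (ih h')).mono (by omega)

theorem single {a b : V} (h : adj a b) : Within adj 1 a b := cons h (refl 0 b)

theorem symm (hs : ∀ x y, adj x y → adj y x) {r : ℕ} {a b : V} (h : Within adj r a b) :
    Within adj r b a := by
  induction h with
  | refl => exact refl _ _
  | cons hab _ ih => exact ih.trans (single (hs _ _ hab))

/-- A walk in a graph enlarged by edges between `v` and a clique `T` can be made to use at most
one of the new edges. -/
theorem of_star {v : V} {T : V → Prop} (hT : ∀ x y, T x → T y → adj x y)
    (hadj : ∀ x y, adj' x y → adj x y ∨ x = y ∨ (x = v ∧ T y) ∨ (T x ∧ y = v))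
    {r : ℕ} {a b : V} (h : Within adj' r a b) :
    Within adj r a b ∨ ∃ t r₁ r₂, T t ∧ r₁ + r₂ + 1 ≤ r ∧
      ((Within adj r₁ a v ∧ Within adj r₂ t b) ∨ (Within adj r₁ a t ∧ Within adj r₂ v b)) := by
  induction h with
  | refl => exact Or.inl (refl _ _)
  | @cons r a c b hac _ ih =>
    rcases hadj _ _ hac with hac | rfl | ⟨rfl, hc⟩ | ⟨ha, rfl⟩
    · rcases ih with ih | ⟨t, r₁, r₂, ht, hr, ⟨h₁, h₂⟩ | ⟨h₁, h₂⟩⟩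
      · exact Or.inl (cons hac ih)
      · exact Or.inr ⟨t, r₁ + 1, r₂, ht, by omega, Or.inl ⟨cons hac h₁, h₂⟩⟩
      · exact Or.inr ⟨t, r₁ + 1, r₂, ht, by omega, Or.inr ⟨cons hac h₁, h₂⟩⟩
    · rcases ih with ih | ⟨t, r₁, r₂, ht, hr, h⟩
      · exact Or.inl (ih.mono (by omega))
      · exact Or.inr ⟨t, r₁, r₂, ht, by omega, h⟩
    -- When a second new edge occurs, the part in between is redundant: a return to `v` is cut out,
    -- and two vertices of `T` are joined directly inside the clique.
    · rcases ih with ih | ⟨t, r₁, r₂, ht, hr, ⟨h₁, h₂⟩ | ⟨h₁, h₂⟩⟩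
      · exact Or.inr ⟨c, 0, r, hc, by omega, Or.inl ⟨refl _ _, ih⟩⟩
      · exact Or.inr ⟨t, 0, r₂, ht, by omega, Or.inl ⟨refl _ _, h₂⟩⟩
      · exact Or.inl (h₂.mono (by omega))
    · rcases ih with ih | ⟨t, r₁, r₂, ht, hr, ⟨h₁, h₂⟩ | ⟨h₁, h₂⟩⟩
      · exact Or.inr ⟨a, 0, r, ha, by omega, Or.inr ⟨refl _ _, ih⟩⟩
      · exact Or.inl ((cons (hT _ _ ha ht) h₂).mono (by omega))
      · exact Or.inr ⟨a, 0, r₂, ha, by omega, Or.inr ⟨refl _ _, h₂⟩⟩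

end Within

/-! ### Partial labellings of a Hamiltonian path -/

/-- Two vertices are adjacent if they are consecutive or carry the same label. -/
def LabelAdj {n k : ℕ} (lab : Fin n → Option (Fin k)) (a b : Fin n) : Prop :=
  a.val + 1 = b.val ∨ b.val + 1 = a.val ∨ ∃ t, lab a = some t ∧ lab b = some t

/-- The labelling with the label `T` removed everywhere. -/
def dissolve {n k : ℕ} (lab : Fin n → Option (Fin k)) (T : Fin k) (a : Fin n) : Option (Fin k) :=
  if lab a = some T then none else lab a

/-- No two vertices with the same label are joined by a walk of length at most `g - 2` that does
not use this label. -/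
def LargeGirth {n k : ℕ} (lab : Fin n → Option (Fin k)) (g : ℕ) : Prop :=
  ∀ T a b, a ≠ b → lab a = some T → lab b = some T → ∀ r, r + 2 ≤ g →
    ¬ Within (LabelAdj (dissolve lab T)) r a b

section Labelling

variable {n k : ℕ} {lab : Fin n → Option (Fin k)}

theorem LabelAdj.symm (a b : Fin n) (h : LabelAdj lab a b) : LabelAdj lab b a := by
  rcases h with h | h | ⟨t, h, h'⟩
  · exact Or.inr (Or.inl h)
  · exact Or.inl h
  · exact Or.inr (Or.inr ⟨t, h', h⟩)

theorem dissolve_eq_some {T t : Fin k} {a : Fin n} :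
    dissolve lab T a = some t ↔ lab a = some t ∧ t ≠ T := by
  unfold dissolve
  split_ifs with h
  · simp only [h, Option.some.injEq, ne_eq, false_iff, not_and, not_not]
    exact fun h => h.symm
  · constructor
    · intro h'
      exact ⟨h', fun hT => h (hT ▸ h')⟩
    · exact fun h' => h'.1

theorem LabelAdj.of_le {lab' : Fin n → Option (Fin k)}
    (hle : ∀ a t, lab a = some t → lab' a = some t) (a b : Fin n) (h : LabelAdj lab a b) :
    LabelAdj lab' a b := by
  rcases h with h | h | ⟨t, h, h'⟩
  · exact Or.inl h
  · exact Or.inr (Or.inl h)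
  · exact Or.inr (Or.inr ⟨t, hle _ _ h, hle _ _ h'⟩)

theorem LargeGirth.of_le {lab' : Fin n → Option (Fin k)} {g : ℕ} (h : LargeGirth lab' g)
    (hle : ∀ a t, lab a = some t → lab' a = some t) : LargeGirth lab g := by
  intro T a b hab ha hb r hr hw
  refine h T a b hab (hle _ _ ha) (hle _ _ hb) r hr (hw.mono_adj (LabelAdj.of_le ?_))
  intro x t hx
  rw [dissolve_eq_some] at hx ⊢
  exact ⟨hle _ _ hx.1, hx.2⟩

/-- Giving the label `T` to an unlabelled vertex that is far from the vertices labelled `T`. -/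
theorem LargeGirth.update {g : ℕ} (h : LargeGirth lab g) {v : Fin n} (hv : lab v = none)
    {T : Fin k}
    (hfar : ∀ t, lab t = some T → ∀ r, r + 2 ≤ g → ¬ Within (LabelAdj lab) r v t) :
    LargeGirth (Function.update lab v (some T)) g := by
  have hold : ∀ {x t}, x ≠ v → Function.update lab v (some T) x = some t → lab x = some t := by
    intro x t hx h
    rwa [Function.update_of_ne hx] at h
  have hdis : ∀ U x y, LabelAdj (dissolve lab U) x y → LabelAdj lab x y := fun U =>
    LabelAdj.of_le fun x t hx => (dissolve_eq_some.1 hx).1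
  have hsymm := LabelAdj.symm (lab := lab)
  intro U a b hab ha hb r hr hw
  by_cases hU : U = T
  · subst hU
    have hd : dissolve (Function.update lab v (some U)) U = dissolve lab U := by
      funext x
      by_cases hx : x = v
      · subst hx
        simp [dissolve, hv]
      · simp [dissolve, Function.update_of_ne hx]
    rw [hd] at hw
    by_cases hav : a = v
    · subst hav
      exact hfar b (hold hab.symm hb) r hr (hw.mono_adj (hdis U))
    · by_cases hbv : b = v
      · subst hbv
        exact hfar a (hold hab ha) r hr ((hw.mono_adj (hdis U)).symm hsymm)
      · exact h U a b hab (hold hav ha) (hold hbv hb) r hr hw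
  · have hav : a ≠ v := by
      rintro rfl
      simp only [Function.update_self, Option.some.injEq] at ha
      exact hU ha.symm
    have hbv : b ≠ v := by
      rintro rfl
      simp only [Function.update_self, Option.some.injEq] at hb
      exact hU hb.symm
    replace ha := hold hav ha
    replace hb := hold hbv hb
    have hba : LabelAdj lab b a := Or.inr (Or.inr ⟨U, hb, ha⟩)
    -- If the walk uses one new edge between `v` and `t`, its two remaining pieces are joined by the
    -- edge of label `U` between `a` and `b`. This leads from `v` to `t` without the new edge and in
    -- at most `r` steps, against `hfar`.
    have key := Within.of_star (adj := LabelAdj (dissolve lab U)) (v := v)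
      (T := fun x => lab x = some T)
      (fun x y hx hy => Or.inr (Or.inr ⟨T, dissolve_eq_some.2 ⟨hx, fun h => hU h.symm⟩,
        dissolve_eq_some.2 ⟨hy, fun h => hU h.symm⟩⟩)) ?_ hw
    · rcases key with key | ⟨t, r₁, r₂, ht, hr', ⟨h₁, h₂⟩ | ⟨h₁, h₂⟩⟩
      · exact h U a b hab ha hb r hr key
      · refine hfar t ht (r₁ + 1 + r₂) (by omega) ?_
        exact (((h₁.mono_adj (hdis U)).symm hsymm).trans (Within.single (hsymm _ _ hba))).trans
          ((h₂.mono_adj (hdis U)).symm hsymm)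
      · refine hfar t ht (r₂ + 1 + r₁) (by omega) ?_
        exact ((h₂.mono_adj (hdis U)).trans (Within.single hba)).trans (h₁.mono_adj (hdis U))
    · rintro x y (hxy | hxy | ⟨t, hx, hy⟩)
      · exact Or.inl (Or.inl hxy)
      · exact Or.inl (Or.inr (Or.inl hxy))
      · rw [dissolve_eq_some] at hx hy
        by_cases hxv : x = v
        · by_cases hyv : y = v
          · exact Or.inr (Or.inl (hxv.trans hyv.symm))
          · subst hxv
            have : t = T := by simpa using hx.1.symm
            subst this
            exact Or.inr (Or.inr (Or.inl ⟨rfl, hold hyv hy.1⟩))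
        · by_cases hyv : y = v
          · subst hyv
            have : t = T := by simpa using hy.1.symm
            subst this
            exact Or.inr (Or.inr (Or.inr ⟨hold hxv hx.1, rfl⟩))
          · exact Or.inl (Or.inr (Or.inr ⟨t, dissolve_eq_some.2 ⟨hold hxv hx.1, hx.2⟩,
              dissolve_eq_some.2 ⟨hold hyv hy.1, hy.2⟩⟩))

/-- A walk to a vertex labelled `S` can be cut at the first vertex labelled `S`. -/
theorem Within.exists_dissolve {S : Fin k} {r : ℕ} {x s : Fin n}
    (h : Within (LabelAdj lab) r x s) (hs : lab s = some S) :
    ∃ s', lab s' = some S ∧ Within (LabelAdj (dissolve lab S)) r x s' := by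
  induction h with
  | refl r a => exact ⟨a, hs, .refl _ _⟩
  | @cons r a b c hab _ ih =>
    obtain ⟨s', hs', hw⟩ := ih hs
    rcases hab with hab | hab | ⟨t, ha, hb⟩
    · exact ⟨s', hs', .cons (Or.inl hab) hw⟩
    · exact ⟨s', hs', .cons (Or.inr (Or.inl hab)) hw⟩
    · by_cases ht : t = S
      · subst ht
        exact ⟨a, ha, .refl _ _⟩
      · exact ⟨s', hs', .cons (Or.inr (Or.inr ⟨t, dissolve_eq_some.2 ⟨ha, ht⟩,
          dissolve_eq_some.2 ⟨hb, ht⟩⟩)) hw⟩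

/-- The label of a remote vertex `w` is passed on to the unlabelled vertex `v`, and `w` receives
the label `T`. -/
theorem LargeGirth.swap {g : ℕ} (h : LargeGirth lab g) {v w : Fin n} (hv : lab v = none)
    {T S : Fin k} (hw : lab w = some S) (hg : 2 ≤ g)
    (hvw : ∀ r, r + 1 ≤ g → ¬ Within (LabelAdj lab) r v w)
    (hwT : ∀ t, lab t = some T → ∀ r, r + 2 ≤ g → ¬ Within (LabelAdj lab) r w t) :
    LargeGirth (Function.update (Function.update lab w (some T)) v (some S)) g := by
  have hsymm := LabelAdj.symm (lab := lab)
  have hne : v ≠ w := by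
    rintro rfl
    simp [hw] at hv
  have hST : S ≠ T := by
    rintro rfl
    exact hwT w hw 0 (by omega) (.refl _ _)
  have hle : ∀ a t, Function.update lab w none a = some t → lab a = some t := by
    intro a t
    by_cases ha : a = w
    · subst ha
      simp
    · simp [Function.update_of_ne ha]
  have hadj := LabelAdj.of_le hle
  have h₁ : LargeGirth (Function.update lab w (some T)) g := by
    have := (h.of_le hle).update (v := w) (T := T) (by simp) fun t ht r hr hwt =>
      hwT t (hle _ _ ht) r hr (hwt.mono_adj hadj)
    rwa [Function.update_idem] at this
  refine h₁.update (by rw [Function.update_of_ne hne, hv]) fun s hs r hr hvs => ?_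
  have hsw : s ≠ w := by
    rintro rfl
    simp only [Function.update_self, Option.some.injEq] at hs
    exact hST hs.symm
  rw [Function.update_of_ne hsw] at hs
  have key := Within.of_star (adj := LabelAdj (Function.update lab w none)) (v := w)
    (T := fun x => Function.update lab w none x = some T)
    (fun x y hx hy => Or.inr (Or.inr ⟨T, hx, hy⟩)) ?_ hvs
  -- Without the new label at `w`, one more step of label `S` takes the walk from `s` to `w`, too
  -- close to `v`. A walk that enters `w` from `t` gives a short walk from `w` to the class of `S`,
  -- hence one that avoids the label `S`, against the girth of `lab`.
  · rcases key with key | ⟨t, r₁, r₂, ht, hr', ⟨h₁, h₂⟩ | ⟨h₁, h₂⟩⟩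
    · exact hvw (r + 1) (by omega)
        ((key.mono_adj hadj).trans (Within.single (Or.inr (Or.inr ⟨S, hs, hw⟩))))
    · exact hvw r₁ (by omega) (h₁.mono_adj hadj)
    · obtain ⟨s', hs', hw'⟩ := h₂.exists_dissolve (S := S)
        (by rw [Function.update_of_ne hsw, hs])
      have hs'w : w ≠ s' := by
        rintro rfl
        simp at hs'
      refine h S w s' hs'w hw (hle _ _ hs') r₂ (by omega) (hw'.mono_adj (LabelAdj.of_le ?_))
      intro x t hx
      rw [dissolve_eq_some] at hx ⊢
      exact ⟨hle _ _ hx.1, hx.2⟩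
  · rintro x y (hxy | hxy | ⟨t, hx, hy⟩)
    · exact Or.inl (Or.inl hxy)
    · exact Or.inl (Or.inr (Or.inl hxy))
    · by_cases hxw : x = w
      · by_cases hyw : y = w
        · exact Or.inr (Or.inl (hxw.trans hyw.symm))
        · subst hxw
          have : t = T := by simpa using hx.symm
          subst this
          refine Or.inr (Or.inr (Or.inl ⟨rfl, ?_⟩))
          rwa [Function.update_of_ne hyw] at hy ⊢
      · by_cases hyw : y = w
        · subst hyw
          have : t = T := by simpa using hy.symm
          subst this
          refine Or.inr (Or.inr (Or.inr ⟨?_, rfl⟩))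
          rwa [Function.update_of_ne hxw] at hx ⊢
        · refine Or.inl (Or.inr (Or.inr ⟨t, ?_, ?_⟩))
          · rwa [Function.update_of_ne hxw] at hx ⊢
          · rwa [Function.update_of_ne hyw] at hy ⊢

end Labelling

/-! ### The size of balls -/

section Ball

variable {n k : ℕ}

/-- The vertices that are reached from the set `X` by a path of length `r` that starts with a
Hamiltonian edge, sorted by the last edge: an edge between equally labelled vertices, a Hamiltonian
edge to the left, or one to the right. -/
def sphere (lab : Fin n → Option (Fin k)) (X : Finset (Fin n)) :
    ℕ → Finset (Fin n) × Finset (Fin n) × Finset (Fin n)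
  | 0 => (X, ∅, ∅)
  | r + 1 =>
    (((sphere lab X r).2.1 ∪ (sphere lab X r).2.2).biUnion fun y =>
        {z | z ≠ y ∧ ∃ t, lab y = some t ∧ lab z = some t},
      Finset.univ.filter fun z => ∃ y ∈ (sphere lab X r).1 ∪ (sphere lab X r).2.1, z.val + 1 = y.val,
      Finset.univ.filter fun z => ∃ y ∈ (sphere lab X r).1 ∪ (sphere lab X r).2.2, y.val + 1 = z.val)

/-- The vertices that are reached from `X` by a path of length at most `r`. -/
def ball (lab : Fin n → Option (Fin k)) (X : Finset (Fin n)) (r : ℕ) : Finset (Fin n) :=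
  (Finset.range (r + 1)).biUnion fun i =>
    (sphere lab X i).1 ∪ ((sphere lab X i).2.1 ∪ (sphere lab X i).2.2)

variable {lab : Fin n → Option (Fin k)} {X : Finset (Fin n)}

theorem mem_ball {r : ℕ} {z : Fin n} : z ∈ ball lab X r ↔ ∃ i ≤ r,
    z ∈ (sphere lab X i).1 ∨ z ∈ (sphere lab X i).2.1 ∨ z ∈ (sphere lab X i).2.2 := by
  simp only [ball, Finset.mem_biUnion, Finset.mem_range, Nat.lt_succ_iff, Finset.mem_union]

/-- Reversing the last edge, or using the same label twice in a row, leads back to a vertex already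
counted. Since `X` is saturated by `hX`, a label edge at the start does not leave it, so it is
enough to count paths that start with a Hamiltonian edge. -/
theorem ball_step (hX : ∀ x ∈ X, ∀ z t, lab x = some t → lab z = some t → z ∈ X) {r : ℕ}
    {z z' : Fin n} (hz : z ∈ ball lab X r) (h : LabelAdj lab z z') : z' ∈ ball lab X (r + 1) := by
  rw [mem_ball] at hz ⊢
  obtain ⟨i, hi, hz⟩ := hz
  have left : ∀ y : Fin n, y ∈ (sphere lab X i).1 ∨ y ∈ (sphere lab X i).2.1 →
      z'.val + 1 = y.val → z' ∈ (sphere lab X (i + 1)).2.1 := by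
    intro y hy hyz
    simp only [sphere, Finset.mem_filter, Finset.mem_univ, true_and, Finset.mem_union]
    exact ⟨y, hy, hyz⟩
  have right : ∀ y : Fin n, y ∈ (sphere lab X i).1 ∨ y ∈ (sphere lab X i).2.2 →
      y.val + 1 = z'.val → z' ∈ (sphere lab X (i + 1)).2.2 := by
    intro y hy hyz
    simp only [sphere, Finset.mem_filter, Finset.mem_univ, true_and, Finset.mem_union]
    exact ⟨y, hy, hyz⟩
  have label : z ∈ (sphere lab X i).2.1 ∨ z ∈ (sphere lab X i).2.2 →
      (∃ t, lab z = some t ∧ lab z' = some t) → z' = z ∨ z' ∈ (sphere lab X (i + 1)).1 := by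
    intro hy ht
    by_cases h : z' = z
    · exact Or.inl h
    · right
      simp only [sphere, Finset.mem_biUnion, Finset.mem_filter, Finset.mem_univ, true_and,
        Finset.mem_union]
      exact ⟨z, hy, h, ht⟩
  rcases h with h | h | h
  · rcases hz with hz | hz | hz
    · exact ⟨i + 1, by omega, Or.inr (Or.inr (right z (Or.inl hz) h))⟩
    · cases i with
      | zero => simp [sphere] at hz
      | succ i =>
        simp only [sphere, Finset.mem_filter, Finset.mem_univ, true_and, Finset.mem_union] at hz
        obtain ⟨y, hy, hyz⟩ := hz
        have : z' = y := Fin.ext (by omega)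
        subst this
        exact ⟨i, by omega, by tauto⟩
    · exact ⟨i + 1, by omega, Or.inr (Or.inr (right z (Or.inr hz) h))⟩
  · rcases hz with hz | hz | hz
    · exact ⟨i + 1, by omega, Or.inr (Or.inl (left z (Or.inl hz) h))⟩
    · exact ⟨i + 1, by omega, Or.inr (Or.inl (left z (Or.inr hz) h))⟩
    · cases i with
      | zero => simp [sphere] at hz
      | succ i =>
        simp only [sphere, Finset.mem_filter, Finset.mem_univ, true_and, Finset.mem_union] at hz
        obtain ⟨y, hy, hyz⟩ := hz
        have : z' = y := Fin.ext (by omega)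
        subst this
        exact ⟨i, by omega, by tauto⟩
  · rcases hz with hz | hz
    · cases i with
      | zero =>
        obtain ⟨t, h, h'⟩ := h
        exact ⟨0, by omega, Or.inl (hX z hz z' t h h')⟩
      | succ i =>
        simp only [sphere, Finset.mem_biUnion, Finset.mem_filter, Finset.mem_univ, true_and,
          Finset.mem_union] at hz
        obtain ⟨y, hy, hyz, t, hty, htz⟩ := hz
        by_cases hzy : z' = y
        · subst hzy
          exact ⟨i, by omega, by tauto⟩
        · refine ⟨i + 1, by omega, Or.inl ?_⟩
          simp only [sphere, Finset.mem_biUnion, Finset.mem_filter, Finset.mem_univ, true_and,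
            Finset.mem_union]
          obtain ⟨t', h, h'⟩ := h
          have : t' = t := by rw [h] at htz; simpa using htz
          subst this
          exact ⟨y, hy, hzy, t', hty, h'⟩
    · rcases label hz h with rfl | h
      · exact ⟨i, by omega, by tauto⟩
      · exact ⟨i + 1, by omega, Or.inl h⟩

theorem mem_ball_of_within (hX : ∀ x ∈ X, ∀ z t, lab x = some t → lab z = some t → z ∈ X)
    {r : ℕ} {x z : Fin n} (hx : x ∈ X) (h : Within (LabelAdj lab) r x z) : z ∈ ball lab X r := by
  have key : ∀ {r : ℕ} {y z : Fin n}, Within (LabelAdj lab) r y z → ∀ j, y ∈ ball lab X j →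
      z ∈ ball lab X (j + r) := by
    intro r y z h
    induction h with
    | refl r a =>
      intro j hj
      rw [mem_ball] at hj ⊢
      obtain ⟨i, hi, h⟩ := hj
      exact ⟨i, by omega, h⟩
    | @cons r a b c hab _ ih =>
      intro j hj
      have := ih (j + 1) (ball_step hX hj hab)
      rwa [show j + 1 + r = j + (r + 1) by omega] at this
  have h0 : x ∈ ball lab X 0 := mem_ball.2 ⟨0, le_rfl, Or.inl hx⟩
  simpa using key h 0 h0

/-- The weights are chosen so that one step multiplies the total by at most `q - 1`. A vertex
reached by a label has two continuations, one reached by a Hamiltonian edge has `q - 1` label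
continuations and one Hamiltonian one; the new weight is at most `(q - 1) (3 (L + R) + 2 C)`, and `3
≤ q - 1`. -/
theorem sphere_weight {q : ℕ} (hq : 4 ≤ q)
    (hcard : ∀ t, (Finset.univ.filter fun z => lab z = some t).card ≤ q) (r : ℕ) :
    (q - 1) * ((sphere lab X r).2.1.card + (sphere lab X r).2.2.card) +
      2 * (sphere lab X r).1.card ≤ 2 * X.card * (q - 1) ^ r := by
  induction r with
  | zero => simp [sphere]
  | succ r ih =>
    set C := (sphere lab X r).1
    set L := (sphere lab X r).2.1
    set R := (sphere lab X r).2.2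
    have hC : (sphere lab X (r + 1)).1.card ≤ (L.card + R.card) * (q - 1) := by
      refine (Finset.card_biUnion_le_card_mul (L ∪ R) _ (q - 1) ?_).trans
        (Nat.mul_le_mul_right _ (Finset.card_union_le _ _))
      intro y _
      rcases hy : lab y with _ | t
      · simp
      · have : (Finset.univ.filter fun z => z ≠ y ∧ ∃ t', some t = some t' ∧ lab z = some t') ⊆
            (Finset.univ.filter fun z => lab z = some t).erase y := by
          intro z hz
          simp only [Finset.mem_filter, Finset.mem_univ, true_and, Option.some.injEq] at hz
          obtain ⟨h, t', rfl, h'⟩ := hz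
          simp [h, h']
        refine (Finset.card_le_card this).trans ?_
        rw [Finset.card_erase_of_mem (by simp [hy])]
        exact Nat.sub_le_sub_right (hcard t) 1
    have hL : (sphere lab X (r + 1)).2.1.card ≤ C.card + L.card := by
      refine le_trans ?_ (Finset.card_union_le C L)
      refine Finset.card_le_card_of_injOn (fun z => if h : z.val + 1 < n then ⟨z.val + 1, h⟩ else z)
        ?_ ?_
      · intro z hz
        simp only [sphere, Finset.coe_filter, Finset.mem_univ, true_and, Set.mem_ofPred_eq] at hz
        obtain ⟨y, hy, hyz⟩ := hz
        have : z.val + 1 < n := hyz ▸ y.2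
        simp only [this, dite_true]
        have : (⟨z.val + 1, this⟩ : Fin n) = y := Fin.ext hyz
        rw [this]
        exact hy
      · intro z hz z' hz' h
        simp only [sphere, Finset.coe_filter, Finset.mem_univ, true_and, Set.mem_ofPred_eq] at hz hz'
        obtain ⟨y, hy, hyz⟩ := hz
        obtain ⟨y', hy', hyz'⟩ := hz'
        have h1 : z.val + 1 < n := hyz ▸ y.2
        have h2 : z'.val + 1 < n := hyz' ▸ y'.2
        simp only [h1, h2, dite_true, Fin.mk.injEq] at h
        exact Fin.ext (by omega)
    have hR : (sphere lab X (r + 1)).2.2.card ≤ C.card + R.card := by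
      refine le_trans ?_ (Finset.card_union_le C R)
      refine Finset.card_le_card_of_injOn (fun z => ⟨z.val - 1, by omega⟩) ?_ ?_
      · intro z hz
        simp only [sphere, Finset.coe_filter, Finset.mem_univ, true_and, Set.mem_ofPred_eq] at hz
        obtain ⟨y, hy, hyz⟩ := hz
        have : (⟨z.val - 1, by omega⟩ : Fin n) = y := Fin.ext (by simp only; omega)
        simp only [this]
        exact hy
      · intro z hz z' hz' h
        simp only [sphere, Finset.coe_filter, Finset.mem_univ, true_and, Set.mem_ofPred_eq] at hz hz'
        obtain ⟨y, hy, hyz⟩ := hz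
        obtain ⟨y', hy', hyz'⟩ := hz'
        simp only [Fin.mk.injEq] at h
        exact Fin.ext (by omega)
    obtain ⟨a, rfl⟩ : ∃ a, q = a + 1 := ⟨q - 1, by omega⟩
    simp only [Nat.add_sub_cancel] at *
    rw [pow_succ]
    have ha : 3 ≤ a := by omega
    calc _ ≤ a * (C.card + L.card + (C.card + R.card)) + 2 * ((L.card + R.card) * a) := by gcongr
      _ = a * (3 * (L.card + R.card) + 2 * C.card) := by ring
      _ ≤ a * (a * (L.card + R.card) + 2 * C.card) := by gcongr
      _ ≤ a * (2 * X.card * a ^ r) := by gcongr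
      _ = _ := by ring

theorem two_mul_card_ball_le {q : ℕ} (hq : 4 ≤ q)
    (hcard : ∀ t, (Finset.univ.filter fun z => lab z = some t).card ≤ q) (r : ℕ) :
    2 * (ball lab X r).card ≤ X.card * (q - 1) ^ (r + 1) := by
  have hs : ∀ i, ((sphere lab X i).1 ∪ ((sphere lab X i).2.1 ∪ (sphere lab X i).2.2)).card ≤
      X.card * (q - 1) ^ i := by
    intro i
    have h1 := sphere_weight (X := X) hq hcard i
    have h2 := Finset.card_union_le (sphere lab X i).1
      ((sphere lab X i).2.1 ∪ (sphere lab X i).2.2)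
    have h3 := Finset.card_union_le (sphere lab X i).2.1 (sphere lab X i).2.2
    have h4 : 2 * ((sphere lab X i).2.1.card + (sphere lab X i).2.2.card) ≤
        (q - 1) * ((sphere lab X i).2.1.card + (sphere lab X i).2.2.card) :=
      Nat.mul_le_mul_right _ (by omega)
    rw [mul_assoc] at h1
    omega
  have hb : (ball lab X r).card ≤ X.card * ∑ i ∈ Finset.range (r + 1), (q - 1) ^ i := by
    rw [Finset.mul_sum]
    exact Finset.card_biUnion_le.trans (Finset.sum_le_sum fun i _ => hs i)
  have hgeom : 2 * ∑ i ∈ Finset.range (r + 1), (q - 1) ^ i ≤ (q - 1) ^ (r + 1) := by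
    clear hb
    induction r with
    | zero => simp; omega
    | succ r ih =>
      rw [Finset.sum_range_succ, mul_add, pow_succ (q - 1) (r + 1)]
      have : (q - 1) ^ (r + 1) * 3 ≤ (q - 1) ^ (r + 1) * (q - 1) :=
        Nat.mul_le_mul_left _ (by omega)
      omega
  calc _ ≤ 2 * (X.card * ∑ i ∈ Finset.range (r + 1), (q - 1) ^ i) := by gcongr
    _ = X.card * (2 * ∑ i ∈ Finset.range (r + 1), (q - 1) ^ i) := by ring
    _ ≤ _ := by gcongr

end Ball

/-! ### Complete labellings of large girth -/

/-- Each round enlarges the set of labelled vertices by one; in the exchange case the class of `S`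
keeps its size, and only the class of `T`, which had room, grows. -/
theorem exists_labelling {q k g : ℕ} (hq : 4 ≤ q) (hg : 2 ≤ g) (hn : q ^ g ≤ k * q) (m : ℕ)
    (hm : m ≤ k * q) : ∃ lab : Fin (k * q) → Option (Fin k), LargeGirth lab g ∧
      (∀ t, (Finset.univ.filter fun z => lab z = some t).card ≤ q) ∧
      m ≤ (Finset.univ.filter fun z => lab z ≠ none).card := by
  induction m with
  | zero => exact ⟨fun _ => none, fun T a b _ ha => by simp at ha, by simp, by simp⟩
  | succ m ih =>
    obtain ⟨lab, hlab, hcard, hmc⟩ := ih (by omega)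
    by_cases hfull : m + 1 ≤ (Finset.univ.filter fun z => lab z ≠ none).card
    · exact ⟨lab, hlab, hcard, hfull⟩
    have hmc' : (Finset.univ.filter fun z => lab z ≠ none).card = m := by omega
    obtain ⟨v, hv⟩ : ∃ v, lab v = none := by
      by_contra! h
      rw [Finset.filter_true_of_mem fun z _ => h z] at hmc'
      simp at hmc'
      omega
    obtain ⟨T, hT⟩ : ∃ T, (Finset.univ.filter fun z => lab z = some T).card < q := by
      by_contra! h
      have : (Finset.univ.filter fun z => lab z ≠ none) =
          Finset.univ.biUnion fun t => Finset.univ.filter fun z => lab z = some t := by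
        ext z
        simp [Option.ne_none_iff_exists']
      rw [this, Finset.card_biUnion] at hmc'
      · have := Finset.sum_le_sum fun t (_ : t ∈ (Finset.univ : Finset (Fin k))) => h t
        simp only [Finset.sum_const, Finset.card_univ, Fintype.card_fin, smul_eq_mul] at this
        omega
      · intro s _ t _ hst
        simp only [Function.onFun, Finset.disjoint_left, Finset.mem_filter, Finset.mem_univ, true_and]
        intro z h1 h2
        rw [h1] at h2
        exact hst (by simpa using h2)
    -- Each of the two balls has at most `(q - 1) ^ g / 2` vertices, so together they have fewer
    -- than `q ^ g ≤ n`.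
    obtain ⟨w, hw⟩ : ∃ w, w ∉ ball lab {v} (g - 1) ∪
        ball lab (Finset.univ.filter fun z => lab z = some T) (g - 2) := by
      by_contra! h
      have h1 := two_mul_card_ball_le (X := {v}) hq hcard (g - 1)
      have h2 := two_mul_card_ball_le (X := Finset.univ.filter fun z => lab z = some T)
        hq hcard (g - 2)
      have h3 := Finset.card_union_le (ball lab {v} (g - 1))
        (ball lab (Finset.univ.filter fun z => lab z = some T) (g - 2))
      rw [Finset.eq_univ_iff_forall.2 h, Finset.card_univ, Fintype.card_fin] at h3
      rw [Finset.card_singleton, one_mul, show g - 1 + 1 = g by omega] at h1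
      rw [show g - 2 + 1 = g - 1 by omega] at h2
      have h4 : (Finset.univ.filter fun z => lab z = some T).card * (q - 1) ^ (g - 1) ≤
          (q - 1) ^ g := by
        conv_rhs => rw [show g = g - 1 + 1 by omega, pow_succ, mul_comm]
        gcongr
        omega
      have h5 : (q - 1) ^ g < q ^ g := Nat.pow_lt_pow_left (by omega) (by omega)
      omega
    rw [Finset.mem_union, not_or] at hw
    have hvw : ∀ r, r + 1 ≤ g → ¬ Within (LabelAdj lab) r v w := fun r hr h =>
      hw.1 (mem_ball_of_within (by simp [hv]) (Finset.mem_singleton_self v) (h.mono (by omega)))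
    have hwT : ∀ t, lab t = some T → ∀ r, r + 2 ≤ g → ¬ Within (LabelAdj lab) r w t :=
      fun t ht r hr h => hw.2 (mem_ball_of_within
        (fun x hx z s hs hz => by
          simp only [Finset.mem_filter, Finset.mem_univ, true_and] at hx ⊢
          rw [hz, ← hs, hx]) (by simpa using ht)
        ((h.symm LabelAdj.symm).mono (by omega)))
    have hvw' : v ≠ w := by
      rintro rfl
      exact hvw 0 (by omega) (.refl _ _)
    have hwT' : lab w ≠ some T := fun h => hwT w h 0 (by omega) (.refl _ _)
    rcases hS : lab w with _ | S
    · refine ⟨_, hlab.update hS hwT, fun t => ?_, ?_⟩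
      · have hsub : (Finset.univ.filter fun z => Function.update lab w (some T) z = some t) ⊆
            if t = T then insert w (Finset.univ.filter fun z => lab z = some T)
              else Finset.univ.filter fun z => lab z = some t := by
          intro z hz
          simp only [Finset.mem_filter, Finset.mem_univ, true_and, Function.update_apply] at hz
          split_ifs at hz ⊢ <;> simp_all
        refine (Finset.card_le_card hsub).trans ?_
        split_ifs
        · exact (Finset.card_insert_le _ _).trans (by omega)
        · exact hcard t
      · have hsub : insert w (Finset.univ.filter fun z => lab z ≠ none) ⊆
            Finset.univ.filter fun z => Function.update lab w (some T) z ≠ none := by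
          intro z hz
          simp only [Finset.mem_insert, Finset.mem_filter, Finset.mem_univ, true_and,
            Function.update_apply] at hz ⊢
          split_ifs <;> simp_all
        refine le_trans ?_ (Finset.card_le_card hsub)
        rw [Finset.card_insert_of_notMem (by simp [hS])]
        omega
    · have hST : S ≠ T := by
        rintro rfl
        exact hwT' hS
      refine ⟨_, hlab.swap hv hS hg hvw hwT, fun t => ?_, ?_⟩
      · have hsub : (Finset.univ.filter fun z =>
            Function.update (Function.update lab w (some T)) v (some S) z = some t) ⊆
            if t = T then insert w (Finset.univ.filter fun z => lab z = some T)
              else if t = S then insert v ((Finset.univ.filter fun z => lab z = some S).erase w)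
              else Finset.univ.filter fun z => lab z = some t := by
          intro z hz
          simp only [Finset.mem_filter, Finset.mem_univ, true_and, Function.update_apply] at hz
          split_ifs at hz ⊢ <;> simp_all
        refine (Finset.card_le_card hsub).trans ?_
        split_ifs
        · exact (Finset.card_insert_le _ _).trans (by omega)
        · refine (Finset.card_insert_le _ _).trans ?_
          rw [Finset.card_erase_add_one (by simp [hS])]
          exact hcard S
        · exact hcard t
      · have hsub : insert v (Finset.univ.filter fun z => lab z ≠ none) ⊆
            Finset.univ.filter fun z =>
              Function.update (Function.update lab w (some T)) v (some S) z ≠ none := by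
          intro z hz
          simp only [Finset.mem_insert, Finset.mem_filter, Finset.mem_univ, true_and,
            Function.update_apply] at hz ⊢
          split_ifs <;> simp_all
        refine le_trans ?_ (Finset.card_le_card hsub)
        rw [Finset.card_insert_of_notMem (by simp [hv])]
        omega

theorem exists_interleaver_largeGirth {q k g : ℕ} (hq : 4 ≤ q) (hg : 2 ≤ g)
    (hn : q ^ g ≤ k * q) :
    ∃ π : Interleaver k q, LargeGirth (fun i => some (π i).divNat) g := by
  obtain ⟨lab, hlab, hcard, hm⟩ := exists_labelling hq hg hn (k * q) le_rfl
  have hall : ∀ z, lab z ≠ none := by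
    have : (Finset.univ.filter fun z => lab z ≠ none) = Finset.univ :=
      Finset.eq_univ_of_card _ (le_antisymm (Finset.card_le_univ _) (by simpa using hm))
    intro z
    have hz := Finset.mem_univ z
    rw [← this] at hz
    simpa using hz
  choose ℓ hℓ using fun z => Option.ne_none_iff_exists'.1 (hall z)
  have hfib : ∀ t, (Finset.univ.filter fun z => ℓ z = t).card = q := by
    have hle : ∀ t ∈ (Finset.univ : Finset (Fin k)),
        (Finset.univ.filter fun z => ℓ z = t).card ≤ q := by
      intro t _
      simpa [hℓ] using hcard t
    -- The `k` classes have at most `q` elements each and `k * q` in total, so every bound is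
    -- attained.
    have hsum : ∑ t, (Finset.univ.filter fun z => ℓ z = t).card = ∑ _t : Fin k, q := by
      rw [← Finset.card_eq_sum_card_fiberwise (fun _ _ => Finset.mem_coe.2 (Finset.mem_univ _))]
      simp
    intro t
    exact (Finset.sum_eq_sum_iff_of_le hle).1 hsum t (Finset.mem_univ t)
  have e : ∀ t, {z // ℓ z = t} ≃ Fin q := fun t =>
    Fintype.equivFinOfCardEq (by rw [Fintype.card_subtype, hfib t])
  refine ⟨(Equiv.sigmaFiberEquiv ℓ).symm.trans ((Equiv.sigmaCongrRight e).trans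
    ((Equiv.sigmaEquivProd _ _).trans finProdFinEquiv)), ?_⟩
  convert hlab using 1
  funext i
  rw [hℓ]
  congr 1
  have : ∀ x : Fin k × Fin q, (finProdFinEquiv x).divNat = x.1 := fun x =>
    congrArg Prod.fst (finProdFinEquiv.symm_apply_apply x)
  rw [Equiv.trans_apply, Equiv.trans_apply, Equiv.trans_apply, this]
  rfl

/-! ### The girth of the auxiliary graph -/

section Girth

variable {k q : ℕ} {π : Interleaver k q}

theorem le_girth_iff {g : ℕ} : (g : ℕ∞) ≤ girth π ↔ ∀ m, HasCycle π m → g ≤ m := by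
  simp [girth]

theorem IsPath.within {m : ℕ} {p : ℕ → Fin (k * q)} {e : ℕ → AuxEdge k q} (h : IsPath π m p e)
    (T : Fin k) {a b : ℕ} (hab : a ≤ b) (hbm : b ≤ m)
    (hT : ∀ j, a ≤ j → j < b → e j ≠ Sum.inr T) :
    Within (LabelAdj (dissolve (fun i => some (π i).divNat) T)) (b - a) (p a) (p b) := by
  induction b, hab using Nat.le_induction with
  | base => exact .refl _ _
  | succ b hab ih =>
    have hadj : LabelAdj (dissolve (fun i => some (π i).divNat) T) (p b) (p (b + 1)) := by
      have hc := h.1 b (by omega)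
      have hne := hT b hab (by omega)
      rcases he : e b with i | t
      · rw [he] at hc
        rcases hc with ⟨rfl, hc⟩ | ⟨rfl, hc⟩
        · exact Or.inl hc.symm
        · exact Or.inr (Or.inl hc.symm)
      · rw [he] at hc hne
        have ht : t ≠ T := fun h => hne (by rw [h])
        simp only [Connects, copies, Finset.mem_filter, Finset.mem_univ, true_and] at hc
        exact Or.inr (Or.inr ⟨t, dissolve_eq_some.2 ⟨congrArg some hc.1, ht⟩,
          dissolve_eq_some.2 ⟨congrArg some hc.2.1, ht⟩⟩)
    have := (ih (by omega) fun j h1 h2 => hT j h1 (by omega)).trans (Within.single hadj)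
    exact this.mono (by omega)

/-- The part of a path between two uses of the same hyperedge closes up to a cycle. -/
theorem IsPath.hasCycle_of_eq {m : ℕ} {p : ℕ → Fin (k * q)} {e : ℕ → AuxEdge k q}
    (h : IsPath π m p e) {T : Fin k} {a b : ℕ} (hab : a < b) (hbm : b < m)
    (ha : e a = Sum.inr T) (hb : e b = Sum.inr T) : ∃ m' < m, HasCycle π m' := by
  have hab' : a + 1 < b := by
    rcases Nat.lt_or_ge (a + 1) b with h' | h'
    · exact h'
    · obtain rfl : b = a + 1 := by omega
      exact absurd (ha.trans hb.symm) (h.2 a hbm)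
  by_cases hp : p b = p (a + 1)
  · refine ⟨b - (a + 1), by omega, by omega, fun j => p (a + 1 + j), fun j => e (a + 1 + j),
      ⟨fun j hj => h.1 (a + 1 + j) (by omega), fun j hj => h.2 (a + 1 + j) (by omega)⟩, ?_⟩
    simpa [show a + 1 + (b - (a + 1)) = b by omega] using hp
  -- Here the hyperedge `T` itself leads from `p b` back to `p (a + 1)`; it may follow `e (b - 1)`,
  -- as it does so on the given path.
  · refine ⟨b - a, by omega, by omega, fun j => if j < b - a then p (a + 1 + j) else p (a + 1),
      fun j => e (a + 1 + j), ⟨fun j hj => ?_, fun j hj => h.2 (a + 1 + j) (by omega)⟩, ?_⟩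
    · by_cases hj' : j + 1 < b - a
      · simp only [hj, hj', if_true]
        exact h.1 (a + 1 + j) (by omega)
      · obtain rfl : b = a + 1 + j := by omega
        simp only [hj, hj', if_true, if_false, hb]
        have h1 := h.1 a (by omega)
        have h2 := h.1 (a + 1 + j) (by omega)
        rw [ha] at h1
        rw [hb] at h2
        exact ⟨h2.1, h1.2.1, hp⟩
    · simp [show 0 < b - a by omega]

/-- A path of positive length that uses only Hamiltonian edges is not closed. -/
theorem IsPath.ne_of_hamiltonian {m : ℕ} {p : ℕ → Fin (k * q)} {e : ℕ → AuxEdge k q}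
    (h : IsPath π m p e) (hm : 1 ≤ m) (he : ∀ j < m, ∃ i, e j = Sum.inl i) : p m ≠ p 0 := by
  have key : ∀ j, j + 1 ≤ m →
      ((p (j + 1)).val = (p 0).val + (j + 1) ∧ (p (j + 1)).val = (p j).val + 1 ∧
        e j = Sum.inl (p j)) ∨
      ((p (j + 1)).val + (j + 1) = (p 0).val ∧ (p j).val = (p (j + 1)).val + 1 ∧
        e j = Sum.inl (p (j + 1))) := by
    intro j
    induction j with
    | zero =>
      intro hj
      obtain ⟨i, hi⟩ := he 0 (by omega)
      have hc := h.1 0 (by omega)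
      rw [hi] at hc ⊢
      rcases hc with ⟨rfl, hc⟩ | ⟨rfl, hc⟩
      · exact Or.inl ⟨by simpa using hc, hc, rfl⟩
      · exact Or.inr ⟨by simpa using hc.symm, hc, rfl⟩
    | succ j ih =>
      intro hj
      obtain ⟨i, hi⟩ := he (j + 1) (by omega)
      have hc := h.1 (j + 1) (by omega)
      have hne := h.2 j (by omega)
      rw [hi] at hc hne ⊢
      rcases ih (by omega) with ⟨h1, h2, h3⟩ | ⟨h1, h2, h3⟩ <;>
        rcases hc with ⟨rfl, hc⟩ | ⟨rfl, hc⟩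
      · exact Or.inl ⟨by omega, hc, rfl⟩
      · refine absurd ?_ hne
        rw [h3]
        exact congrArg _ (Fin.ext (by omega))
      · exact absurd h3 hne
      · exact Or.inr ⟨by omega, hc, rfl⟩
  obtain ⟨m, rfl⟩ : ∃ m', m = m' + 1 := ⟨m - 1, by omega⟩
  intro heq
  rw [Fin.ext_iff] at heq
  rcases key m le_rfl with h | h <;> omega

/-- A shortest cycle uses each hyperedge at most once. Removing one that it uses leaves a walk, one
step shorter, that avoids this label and joins two of its vertices. A cycle without hyperedges would
be a closed monotone run along the Hamiltonian path. -/
theorem LargeGirth.le_girth {g : ℕ} (h : LargeGirth (fun i => some (π i).divNat) g) :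
    (g : ℕ∞) ≤ girth π := by
  classical
  rw [le_girth_iff]
  intro m₀ hm₀
  by_contra! hlt
  have hex : ∃ m, HasCycle π m := ⟨m₀, hm₀⟩
  obtain ⟨hm, p, e, hp, hclosed⟩ := Nat.find_spec hex
  have hmin := fun m' => Nat.find_min (H := hex) (m := m')
  have hfind := Nat.find_min' hex hm₀
  generalize Nat.find hex = m at hm hp hclosed hmin hfind
  by_cases hT : ∃ j < m, ∃ T, e j = Sum.inr T
  · obtain ⟨j, hj, T, hjT⟩ := hT
    have huniq : ∀ i < m, i ≠ j → e i ≠ Sum.inr T := by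
      intro i hi hij hiT
      rcases Nat.lt_or_gt_of_ne hij with hij | hij
      · obtain ⟨m', hm', hc⟩ := hp.hasCycle_of_eq hij hj hiT hjT
        exact hmin m' hm' hc
      · obtain ⟨m', hm', hc⟩ := hp.hasCycle_of_eq hij hi hjT hiT
        exact hmin m' hm' hc
    have h1 := hp.within T (a := j + 1) (b := m) (by omega) le_rfl
      fun i hi him => huniq i him (by omega)
    have h2 := hp.within T (a := 0) (b := j) (by omega) (by omega)
      fun i hi him => huniq i (by omega) (by omega)
    rw [hclosed] at h1
    have hc := hp.1 j hj
    rw [hjT] at hc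
    simp only [Connects, copies, Finset.mem_filter, Finset.mem_univ, true_and] at hc
    exact h T (p (j + 1)) (p j) (Ne.symm hc.2.2) (congrArg some hc.2.1) (congrArg some hc.1) _
      (by omega) (h1.trans h2)
  · push Not at hT
    refine hp.ne_of_hamiltonian hm (fun j hj => ?_) hclosed
    rcases hej : e j with i | T
    · exact ⟨i, rfl⟩
    · exact absurd hej (hT j hj T)

end Girth

/-- Interleavers whose auxiliary graph has logarithmic girth. -/
theorem exists_interleaver_le_girth {q k g : ℕ} (hq : 4 ≤ q) (hg : 2 ≤ g) (hn : q ^ g ≤ k * q) :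
    ∃ π : Interleaver k q, (g : ℕ∞) ≤ girth π :=
  (exists_interleaver_largeGirth hq hg hn).imp fun _ => LargeGirth.le_girth

/-! ### Cheap chains of a stationary flow -/

/-- If the expected cost of a state is nonpositive under a stationary flow, then the flow contains
chains of every length whose total cost is nonpositive. -/
theorem exists_chain_of_stationary {S : Type*} [Fintype S] (F : S → S → ℝ) (d γ : S → ℝ)
    (hF : ∀ s t, 0 ≤ F s t) (hrow : ∀ s, ∑ t, F s t = d s) (hcol : ∀ t, ∑ s, F s t = d t)
    (hγ : ∑ s, d s * γ s ≤ 0) (hd : ∃ s, 0 < d s) (h : ℕ) :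
    ∃ s l, l.length = h ∧ (s :: l).IsChain (fun s t => 0 < F s t) ∧ (∀ t ∈ s :: l, 0 < d t) ∧
      ((s :: l).map γ).sum ≤ 0 := by
  classical
  have hd0 : ∀ s, 0 ≤ d s := fun s => hrow s ▸ Finset.sum_nonneg fun t _ => hF s t
  have hpos : ∀ s t, 0 < F s t → 0 < d t := fun s t hst =>
    hcol t ▸ hst.trans_le (Finset.single_le_sum (f := fun s => F s t) (fun s _ => hF s t)
      (Finset.mem_univ s))
  -- The induction needs a chain from every charged state at once, with only the `d`-average of the
  -- costs controlled.
  have key : ∃ L : S → List S, (∀ s, 0 < d s → (L s).length = h ∧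
      (s :: L s).IsChain (fun s t => 0 < F s t) ∧ (∀ t ∈ s :: L s, 0 < d t)) ∧
      ∑ s, d s * ((s :: L s).map γ).sum ≤ 0 := by
    induction h with
    | zero => exact ⟨fun _ => [], fun s hs => by simpa using hs, by simpa using hγ⟩
    | succ h ih =>
      obtain ⟨L, hL, hsum⟩ := ih
      set V : S → ℝ := fun s => ((s :: L s).map γ).sum with hV
      -- Some successor is no dearer than the average over successors; stationarity then turns the
      -- sum of these averages into the previous `d`-average.
      have hnext : ∀ s, 0 < d s → ∃ t, 0 < F s t ∧ d s * V t ≤ ∑ t, F s t * V t := by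
        intro s hs
        by_contra! hcon
        obtain ⟨t₀, ht₀⟩ : ∃ t, 0 < F s t := by
          by_contra! h0
          exact hs.not_ge (hrow s ▸ Finset.sum_nonpos fun t _ => h0 t)
        have hlt : ∑ t, F s t * (∑ t, F s t * V t) < ∑ t, F s t * (d s * V t) := by
          refine Finset.sum_lt_sum (fun t _ => ?_)
            ⟨t₀, Finset.mem_univ _, mul_lt_mul_of_pos_left (hcon t₀ ht₀) ht₀⟩
          rcases (hF s t).eq_or_lt with h0 | h0
          · simp [← h0]
          · exact (mul_lt_mul_of_pos_left (hcon t h0) h0).le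
        rw [← Finset.sum_mul, hrow, Finset.mul_sum] at hlt
        exact hlt.ne (Finset.sum_congr rfl fun t _ => by ring)
      choose! next hnext using hnext
      refine ⟨fun s => next s :: L (next s), fun s hs => ?_, ?_⟩
      · obtain ⟨h1, h2, h3⟩ := hL (next s) (hpos s _ (hnext s hs).1)
        refine ⟨by simp [h1], List.isChain_cons_cons.2 ⟨(hnext s hs).1, h2⟩, fun t ht => ?_⟩
        rcases List.mem_cons.1 ht with rfl | ht
        · exact hs
        · exact h3 t ht
      · have h1 : ∀ s, d s * ((s :: next s :: L (next s)).map γ).sum ≤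
            d s * γ s + ∑ t, F s t * V t := by
          intro s
          have : ((s :: next s :: L (next s)).map γ).sum = γ s + V (next s) := by
            rw [List.map_cons, List.sum_cons]
          rw [this, mul_add]
          rcases (hd0 s).eq_or_lt with h0 | h0
          · have hz : ∀ t, F s t = 0 := fun t =>
              (Finset.sum_eq_zero_iff_of_nonneg fun t _ => hF s t).1 ((hrow s).trans h0.symm) t
                (Finset.mem_univ t)
            simp [← h0, hz]
          · have := (hnext s h0).2
            linarith
        have h2 : ∑ s, ∑ t, F s t * V t = ∑ s, d s * V s := by
          rw [Finset.sum_comm]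
          exact Finset.sum_congr rfl fun t _ => by rw [← Finset.sum_mul, hcol]
        calc _ ≤ ∑ s, (d s * γ s + ∑ t, F s t * V t) := Finset.sum_le_sum fun s _ => h1 s
          _ = ∑ s, d s * γ s + ∑ s, d s * V s := by rw [Finset.sum_add_distrib, h2]
          _ ≤ 0 := by linarith
  obtain ⟨L, hL, hsum⟩ := key
  obtain ⟨s, hs, hle⟩ : ∃ s, 0 < d s ∧ ((s :: L s).map γ).sum ≤ 0 := by
    by_contra! hcon
    obtain ⟨s₀, hs₀⟩ := hd
    refine hsum.not_gt (Finset.sum_pos' (fun s _ => ?_)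
      ⟨s₀, Finset.mem_univ _, mul_pos hs₀ (hcon s₀ hs₀)⟩)
    rcases (hd0 s).eq_or_lt with h0 | h0
    · simp [← h0]
    · exact (mul_pos h0 (hcon s h0)).le
  exact ⟨s, L s, (hL s hs).1, (hL s hs).2.1, (hL s hs).2.2, hle⟩

/-! ### Darts of the Hamiltonian cycle -/

/-- The cyclic successor on `Fin n`. -/
def cyclicSucc (n : ℕ) : Equiv.Perm (Fin n) := finRotate n

theorem val_cyclicSucc {n : ℕ} (v : Fin n) (h : v.val + 1 < n) :
    (cyclicSucc n v).val = v.val + 1 := by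
  cases n with
  | zero => exact v.elim0
  | succ n =>
    have : v = ⟨v.val, by omega⟩ := rfl
    rw [this, cyclicSucc, finRotate_of_lt (by omega)]

/-- The dart `(v, true)` leaves `v` for the next vertex of the cycle, and `(v, false)` leaves it for
the previous one. -/
abbrev Dart (n : ℕ) : Type := Fin n × Bool

namespace Dart

variable {n : ℕ}

/-- The same edge in the opposite direction. -/
def back (s : Dart n) : Dart n :=
  (if s.2 then cyclicSucc n s.1 else (cyclicSucc n).symm s.1, !s.2)

/-- The edge that joins `i` to the next vertex of the cycle has the index `i`. -/
def edge (s : Dart n) : Fin n := if s.2 then s.1 else (cyclicSucc n).symm s.1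

theorem back_back (s : Dart n) : s.back.back = s := by
  obtain ⟨v, _ | _⟩ := s <;> simp [back]

/-- Reversal of darts. -/
def backEquiv : Dart n ≃ Dart n := ⟨back, back, back_back, back_back⟩

theorem edge_back (s : Dart n) : s.back.edge = s.edge := by
  obtain ⟨v, _ | _⟩ := s <;> simp [back, edge]

theorem eq_or_eq_back_of_edge_eq {s t : Dart n} (h : s.edge = t.edge) : s = t ∨ s = t.back := by
  obtain ⟨v, _ | _⟩ := s <;> obtain ⟨w, _ | _⟩ := t <;>
    simp_all [back, edge, Equiv.symm_apply_eq]

/-- The edges that can be used after arriving at the vertex `x.1` along the edge of `x`. -/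
def Follows {k : ℕ} (lab : Fin n → Fin k) (x y : Dart n) : Prop :=
  (x.1 = y.1 ∧ x.2 ≠ y.2) ∨ (x.1 ≠ y.1 ∧ lab x.1 = lab y.1)

instance {k : ℕ} (lab : Fin n → Fin k) (x y : Dart n) : Decidable (Follows lab x y) :=
  inferInstanceAs (Decidable (_ ∨ _))

theorem card_follows {k : ℕ} {lab : Fin n → Fin k} {q : ℕ} (hq : 1 ≤ q)
    (hlab : ∀ t, (Finset.univ.filter fun v => lab v = t).card = q) (x : Dart n) :
    (Finset.univ.filter fun y => Follows lab x y).card ≤ 2 * q - 1 := by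
  have hsub : (Finset.univ.filter fun y => Follows lab x y) ⊆
      insert (x.1, !x.2)
        (((Finset.univ.filter fun v => lab v = lab x.1).erase x.1) ×ˢ (Finset.univ : Finset Bool)) := by
    rintro ⟨w, τ⟩ hy
    replace hy := (Finset.mem_filter.1 hy).2
    unfold Follows at hy
    rw [Finset.mem_insert]
    rcases hy with ⟨h1, h2⟩ | ⟨h1, h2⟩
    · left
      ext1
      · exact h1.symm
      · simpa [eq_comm, Bool.eq_not] using h2
    · right
      simp [h2, Ne.symm h1]
  refine (Finset.card_le_card hsub).trans ((Finset.card_insert_le _ _).trans ?_)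
  rw [Finset.card_product, Finset.card_erase_of_mem (by simp), hlab]
  simp only [Finset.card_univ, Fintype.card_bool]
  omega

/-- The walks along `h + 1` darts that start with a given dart. -/
def walks {k : ℕ} (lab : Fin n → Fin k) : ℕ → Dart n → Finset (List (Dart n))
  | 0, s => {[s]}
  | h + 1, s => (Finset.univ.filter fun t => Follows lab s.back t).biUnion fun t =>
      (walks lab h t).image (s :: ·)

theorem card_walks_le {k : ℕ} {lab : Fin n → Fin k} {q : ℕ} (hq : 1 ≤ q)
    (hlab : ∀ t, (Finset.univ.filter fun v => lab v = t).card = q) (h : ℕ) (s : Dart n) :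
    (walks lab h s).card ≤ (2 * q - 1) ^ h := by
  induction h generalizing s with
  | zero => simp [walks]
  | succ h ih =>
    rw [walks, pow_succ']
    exact (Finset.card_biUnion_le_card_mul _ _ ((2 * q - 1) ^ h) fun t _ =>
      Finset.card_image_le.trans (ih t)).trans (Nat.mul_le_mul_right _ (card_follows hq hlab _))

theorem mem_walks {k : ℕ} {lab : Fin n → Fin k} {s : Dart n} {l : List (Dart n)}
    (hl : (s :: l).IsChain fun s t => Follows lab s.back t) : s :: l ∈ walks lab l.length s := by
  induction l generalizing s with
  | nil => simp [walks]
  | cons t l ih =>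
    rw [List.isChain_cons_cons] at hl
    rw [List.length_cons, walks, Finset.mem_biUnion]
    exact ⟨t, by simpa using hl.1, Finset.mem_image_of_mem _ (ih hl.2)⟩

end Dart

/-! ### The walk defined by a flow -/

section Flow

variable {n k : ℕ} {lab : Fin n → Fin k} {q : ℕ}

open Dart

/-- The flow that turns from the edge of a dart to the hyperedge at its first vertex. -/
def turn (β κ : Fin n → ℝ) (x : Dart n) : ℝ := if x.2 then κ x.1 else β x.1

/-- The flow that arrives along the edge of `x` at the vertex `x.1` and, possibly after using the
hyperedge at this vertex, leaves along the edge of `y`. -/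
noncomputable def transition (lab : Fin n → Fin k) (q : ℕ) (α β κ : Fin n → ℝ) (δ : Fin k → ℝ)
    (x y : Dart n) : ℝ :=
  if x.1 = y.1 then (if x.2 ≠ y.2 then α x.1 else 0)
  else if lab x.1 = lab y.1 then turn β κ x * turn β κ y / ((q - 1) * δ (lab x.1)) else 0

/-- Together with the reversal of darts, this symmetry turns column sums into row sums and so gives
stationarity. -/
theorem transition_comm (α β κ : Fin n → ℝ) (δ : Fin k → ℝ) (x y : Dart n) :
    transition lab q α β κ δ x y = transition lab q α β κ δ y x := by
  unfold transition
  by_cases h : x.1 = y.1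
  · simp only [h, if_true, ne_eq, eq_comm]
  · by_cases h' : lab x.1 = lab y.1
    · simp only [h, Ne.symm h, h', if_true, if_false, mul_comm]
    · simp only [h, Ne.symm h, h', Ne.symm h', if_false]

/-- The two turns at another copy `w` add up to `δ`, so each of the `q - 1` other copies receives
the same share of `turn β κ x`. -/
theorem sum_transition (hq : 2 ≤ q)
    (hlab : ∀ t, (Finset.univ.filter fun v => lab v = t).card = q)
    {α β κ : Fin n → ℝ} {δ : Fin k → ℝ} (hβ : ∀ v, 0 ≤ β v) (hκ : ∀ v, 0 ≤ κ v)
    (hδ : ∀ v, β v + κ v = δ (lab v)) (x : Dart n) :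
    ∑ y, transition lab q α β κ δ x y = α x.1 + turn β κ x := by
  have hq' : (0 : ℝ) < q - 1 := by
    have : (2 : ℝ) ≤ q := by exact_mod_cast hq
    linarith
  rw [Fintype.sum_prod_type]
  have h1 : ∀ w : Fin n, ∑ τ : Bool, transition lab q α β κ δ x (w, τ) =
      if w = x.1 then α x.1
      else if lab w = lab x.1 then turn β κ x * δ (lab x.1) / ((q - 1) * δ (lab x.1)) else 0 := by
    intro w
    rw [Fintype.sum_bool]
    by_cases hw : w = x.1
    · rw [if_pos hw]
      simp only [transition, hw, if_true]
      rcases x.2 <;> simp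
    · have hw' : ¬ x.1 = w := fun h => hw h.symm
      by_cases hl : lab w = lab x.1
      · simp only [transition, if_neg hw, if_neg hw', hl, if_true]
        rw [← add_div, ← mul_add, show turn β κ (w, true) + turn β κ (w, false) = δ (lab x.1) by
          rw [← hl, ← hδ w]
          simp [turn, add_comm]]
      · simp only [transition, if_neg hw, if_neg hw', if_neg hl,
          if_neg (fun h : lab x.1 = lab w => hl h.symm), add_zero]
  simp only [h1]
  rw [← Finset.add_sum_erase _ _ (Finset.mem_univ x.1), if_pos rfl]
  congr 1
  rw [Finset.sum_congr rfl fun w hw => if_neg (Finset.ne_of_mem_erase hw), ← Finset.sum_filter,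
    Finset.sum_const]
  have h2 : (Finset.filter (fun w => lab w = lab x.1) (Finset.univ.erase x.1)).card = q - 1 := by
    rw [← hlab (lab x.1), ← Finset.card_erase_of_mem (s := Finset.univ.filter fun v =>
      lab v = lab x.1) (a := x.1) (by simp)]
    congr 1
    ext w
    simp [and_comm]
  rw [h2, nsmul_eq_mul, Nat.cast_sub (by omega), Nat.cast_one]
  -- If `δ` vanishes, both turns vanish too, and the quotient with value `0` is the right one.
  by_cases h0 : δ (lab x.1) = 0
  · have hs := hδ x.1
    have : turn β κ x = 0 := by
      have h3 := hβ x.1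
      have h4 := hκ x.1
      unfold turn
      split_ifs <;> linarith
    simp [this]
  · field_simp

/-- A nonzero flow of nonpositive cost contains walks of every length of nonpositive cost. -/
theorem exists_walk_of_flow (hq : 2 ≤ q)
    (hlab : ∀ t, (Finset.univ.filter fun v => lab v = t).card = q)
    {α β κ d γ : Fin n → ℝ} {δ : Fin k → ℝ} (hα : ∀ v, 0 ≤ α v) (hβ : ∀ v, 0 ≤ β v)
    (hκ : ∀ v, 0 ≤ κ v) (hδ : ∀ v, β v + κ v = δ (lab v)) (hout : ∀ v, α v + κ v = d v)
    (hin : ∀ v, α (cyclicSucc n v) + β (cyclicSucc n v) = d v) (hd : ∃ v, 0 < d v)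
    (hγ : ∑ v, d v * γ v ≤ 0) (h : ℕ) :
    ∃ s l, l.length = h ∧ (s :: l).IsChain (fun s t => Follows lab s.back t) ∧
      (∀ t ∈ s :: l, 0 < d t.edge) ∧ ((s :: l).map fun t => γ t.edge).sum ≤ 0 := by
  have hq' : (0 : ℝ) < q - 1 := by
    have : (2 : ℝ) ≤ q := by exact_mod_cast hq
    linarith
  have hturn : ∀ x, 0 ≤ turn β κ x := by
    intro x
    unfold turn
    split_ifs
    · exact hκ _
    · exact hβ _
  have hδ0 : ∀ v, 0 ≤ δ (lab v) := fun v => hδ v ▸ add_nonneg (hβ v) (hκ v)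
  have hD : ∀ s : Dart n, α s.1 + turn β κ s = d s.edge := by
    rintro ⟨v, _ | _⟩
    · simpa [turn, edge] using hin ((cyclicSucc n).symm v)
    · simpa [turn, edge] using hout v
  have hnonneg : ∀ x y, 0 ≤ transition lab q α β κ δ x y := by
    intro x y
    unfold transition
    split_ifs
    · exact hα _
    · exact le_rfl
    · exact div_nonneg (mul_nonneg (hturn x) (hturn y)) (mul_nonneg hq'.le (hδ0 _))
    · exact le_rfl
  have hrow := sum_transition (α := α) hq hlab hβ hκ hδ
  obtain ⟨s, l, h1, h2, h3, h4⟩ := exists_chain_of_stationary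
    (fun s t : Dart n => transition lab q α β κ δ s.back t) (fun s => d s.edge)
    (fun s => γ s.edge) (fun s t => hnonneg _ _)
    (fun s => by rw [hrow, hD, edge_back])
    (fun t => by
      rw [← hD, ← hrow]
      exact (Equiv.sum_comp backEquiv fun x => transition lab q α β κ δ x t).trans
        (Finset.sum_congr rfl fun x _ => transition_comm _ _ _ _ _ _))
    (by
      -- Every edge carries two darts, so the mean cost is twice the given sum.
      rw [Fintype.sum_prod_type_right, Fintype.sum_bool]
      have h1 : ∑ v : Fin n, d (edge (v, false)) * γ (edge (v, false)) = ∑ v, d v * γ v :=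
        Equiv.sum_comp (cyclicSucc n).symm fun v => d v * γ v
      have h2 : ∑ v : Fin n, d (edge (v, true)) * γ (edge (v, true)) = ∑ v, d v * γ v := rfl
      rw [h1, h2]
      linarith)
    (by
      obtain ⟨v, hv⟩ := hd
      exact ⟨(v, true), hv⟩) h
  refine ⟨s, l, h1, h2.imp fun s t hst => ?_, h3, h4⟩
  unfold transition at hst
  unfold Follows
  split_ifs at hst with h5 h6 h6
  · exact Or.inl ⟨h5, h6⟩
  · exact absurd hst (lt_irrefl _)
  · exact Or.inr ⟨h5, h6⟩
  · exact absurd hst (lt_irrefl _)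

end Flow

/-! ### Walks that are shorter than the girth -/

section Simple

variable {k q : ℕ} {π : Interleaver k q}

theorem IsPath.cons {m : ℕ} {p : ℕ → Fin (k * q)} {e : ℕ → AuxEdge k q} (h : IsPath π m p e)
    {a : Fin (k * q)} {e₀ : AuxEdge k q} (hc : Connects π e₀ a (p 0)) (hne : e₀ ≠ e 0) :
    IsPath π (m + 1) (fun j => j.casesOn a p) (fun j => j.casesOn e₀ e) := by
  constructor
  · rintro (_ | j) hj
    · exact hc
    · exact h.1 j (by omega)
  · rintro (_ | j) hj
    · exact hne
    · exact h.2 j (by omega)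

theorem IsPath.take {m m' : ℕ} {p : ℕ → Fin (k * q)} {e : ℕ → AuxEdge k q} (h : IsPath π m p e)
    (hm : m' ≤ m) : IsPath π m' p e :=
  ⟨fun j hj => h.1 j (by omega), fun j hj => h.2 j (by omega)⟩

open Dart

theorem connects_edge {s : Dart (k * q)} (hs : s.edge.val + 1 < k * q) :
    Connects π (Sum.inl s.edge) s.1 s.back.1 := by
  obtain ⟨v, _ | _⟩ := s
  · refine Or.inr ⟨by simp [edge, back], ?_⟩
    have := val_cyclicSucc _ hs
    simpa [edge] using this
  · exact Or.inl ⟨by simp [edge], by simpa [edge, back] using val_cyclicSucc _ hs⟩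

/-- Only on a cycle with a single vertex do both darts at a vertex lie on the same edge; `hx`
excludes this case. -/
theorem edge_ne_of_turn {n : ℕ} {x y : Dart n} (hx : x.edge.val + 1 < n) (h1 : x.1 = y.1)
    (h2 : x.2 ≠ y.2) : x.edge ≠ y.edge := by
  intro h
  rw [Fin.ext_iff] at h
  have hy : y.edge.val + 1 < n := h ▸ hx
  obtain ⟨v, _ | _⟩ := x <;> obtain ⟨w, _ | _⟩ := y <;> simp only [ne_eq, not_true] at h1 h2
  · have := val_cyclicSucc _ hx
    simp [edge] at this h
    omega
  · have := val_cyclicSucc _ hy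
    simp [edge] at this h
    omega

/-- The path of the auxiliary graph along a walk of darts. -/
theorem exists_isPath_of_chain {l : List (Dart (k * q))} {s t : Dart (k * q)}
    (hchain : (s :: (l ++ [t])).IsChain fun s t => Follows (fun i => (π i).divNat) s.back t)
    (hval : ∀ u ∈ s :: (l ++ [t]), u.edge.val + 1 < k * q) :
    ∃ m p e, IsPath π (m + 1) p e ∧ p 0 = s.1 ∧ e 0 = Sum.inl s.edge ∧ p m = t.1 ∧
      p (m + 1) = t.back.1 ∧ 1 ≤ m ∧ m ≤ 2 * (l.length + 1) := by
  have step : ∀ {s u : Dart (k * q)} {m : ℕ} {p : ℕ → Fin (k * q)} {e : ℕ → AuxEdge k q},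
      Follows (fun i => (π i).divNat) s.back u → s.edge.val + 1 < k * q →
      u.edge.val + 1 < k * q → IsPath π (m + 1) p e → p 0 = u.1 → e 0 = Sum.inl u.edge →
      ∃ m' p' e', IsPath π (m' + 1) p' e' ∧ p' 0 = s.1 ∧ e' 0 = Sum.inl s.edge ∧
        p' m' = p m ∧ p' (m' + 1) = p (m + 1) ∧ m + 1 ≤ m' ∧ m' ≤ m + 2 := by
    intro s u m p e hsu hs hu hp hp0 he0
    have hc := connects_edge (π := π) hs
    rcases hsu with ⟨h1, h2⟩ | ⟨h1, h2⟩
    · refine ⟨m + 1, _, _, hp.cons (a := s.1) (e₀ := Sum.inl s.edge) (by rwa [hp0, ← h1]) ?_,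
        rfl, rfl, rfl, rfl, le_rfl, by omega⟩
      rw [he0, ← edge_back s]
      exact fun h => edge_ne_of_turn (by rwa [edge_back]) h1 h2 (Sum.inl_injective h)
    · have hp' := hp.cons (a := s.back.1) (e₀ := Sum.inr (π s.back.1).divNat)
        (by
          rw [hp0]
          simpa [Connects, copies] using ⟨h2.symm, h1⟩) (by simp [he0])
      exact ⟨m + 2, _, _, hp'.cons (a := s.1) (e₀ := Sum.inl s.edge) hc (by simp),
        rfl, rfl, rfl, rfl, by omega, le_rfl⟩
  induction l generalizing s with
  | nil =>
    rw [List.nil_append, List.isChain_cons_cons] at hchain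
    have ht := hval t (by simp)
    obtain ⟨m, p, e, h1, h2, h3, h4, h5, h6, h7⟩ := step (m := 0)
      (p := fun j => j.casesOn t.1 fun _ => t.back.1) (e := fun _ => Sum.inl t.edge)
      hchain.1 (hval s (by simp)) ht
      ⟨fun j hj => by
        obtain rfl : j = 0 := by omega
        exact connects_edge ht, fun j hj => by omega⟩ rfl rfl
    exact ⟨m, p, e, h1, h2, h3, h4, h5, by omega, by simpa using h7⟩
  | cons u l ih =>
    rw [List.cons_append, List.isChain_cons_cons] at hchain
    obtain ⟨m, p, e, h1, h2, h3, h4, h5, h6, h7⟩ := ih hchain.2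
      fun v hv => hval v (List.mem_cons_of_mem _ hv)
    obtain ⟨m', p', e', g1, g2, g3, g4, g5, g6, g7⟩ := step hchain.1 (hval s (by simp))
      (hval u (by simp)) h1 h2 h3
    refine ⟨m', p', e', g1, g2, g3, g4.trans h4, g5.trans h5, by omega, ?_⟩
    rw [List.length_cons]
    omega

theorem nodup_edges_of_chain {l : List (Dart (k * q))}
    (hchain : l.IsChain fun s t => Follows (fun i => (π i).divNat) s.back t)
    (hval : ∀ u ∈ l, u.edge.val + 1 < k * q) {g : ℕ} (hg : (g : ℕ∞) ≤ girth π)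
    (hl : 2 * l.length ≤ g) : (l.map edge).Nodup := by
  rw [le_girth_iff] at hg
  induction l with
  | nil => simp
  | cons s l ih =>
    rw [List.length_cons] at hl
    rw [List.map_cons, List.nodup_cons]
    refine ⟨fun hmem => ?_, ih (List.IsChain.tail hchain)
      (fun u hu => hval u (List.mem_cons_of_mem _ hu)) (by omega)⟩
    obtain ⟨t, ht, hts⟩ := List.mem_map.1 hmem
    obtain ⟨l₁, l₂, rfl⟩ := List.append_of_mem ht
    have hsplit : s :: (l₁ ++ t :: l₂) = (s :: (l₁ ++ [t])) ++ l₂ := by simp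
    rw [hsplit] at hchain hval
    obtain ⟨m, p, e, h1, h2, h3, h4, h5, h6, h7⟩ := exists_isPath_of_chain
      (List.IsChain.left_of_append hchain) fun u hu => hval u (List.mem_append_left _ hu)
    simp only [List.length_append, List.length_cons] at hl
    -- A repetition in the same direction closes up before the last edge, one in the opposite
    -- direction after it. The length is at most `2 * l₁.length + 3`, while `g` is at least `2 *
    -- l₁.length + 4`.
    rcases eq_or_eq_back_of_edge_eq hts with rfl | rfl
    · have := hg m ⟨h6, p, e, h1.take (by omega), h4.trans h2.symm⟩
      omega
    · have := hg (m + 1) ⟨by omega, p, e, h1, by rw [h5, back_back, h2]⟩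
      omega

end Simple

/-! ### Gaussian tails -/

/-- Dropping `x ^ 2` from `(x - μ) ^ 2` leaves an exponential with integral `v / μ` over the
half-line. -/
theorem gaussianReal_real_Iic_zero_le {μ : ℝ} (hμ : 0 < μ) {v : NNReal} (hv : v ≠ 0) :
    (gaussianReal μ v).real (Set.Iic 0) ≤ Real.sqrt v / μ * Real.exp (-μ ^ 2 / (2 * v)) := by
  have hv' : (0 : ℝ) < v := by positivity
  have hs : 0 < Real.sqrt v := Real.sqrt_pos.2 hv'
  have ha : 0 < μ / v := by positivity
  have hint : IntegrableOn (fun x => (Real.sqrt (2 * Real.pi * v))⁻¹ *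
      Real.exp (-μ ^ 2 / (2 * v)) * Real.exp (μ / v * x)) (Set.Iic 0) :=
    (integrableOn_exp_mul_Iic ha 0).const_mul _
  rw [measureReal_def, gaussianReal_apply_eq_integral μ hv, ENNReal.toReal_ofReal
    (integral_nonneg fun x => gaussianPDFReal_nonneg μ v x)]
  calc ∫ x in Set.Iic 0, gaussianPDFReal μ v x
      ≤ ∫ x in Set.Iic 0, (Real.sqrt (2 * Real.pi * v))⁻¹ *
          Real.exp (-μ ^ 2 / (2 * v)) * Real.exp (μ / v * x) := by
        refine setIntegral_mono (integrable_gaussianPDFReal μ v).integrableOn hint fun x => ?_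
        rw [gaussianPDFReal, mul_assoc (Real.sqrt _)⁻¹, ← Real.exp_add]
        gcongr
        rw [show -μ ^ 2 / (2 * (v : ℝ)) + μ / v * x = (-μ ^ 2 + 2 * μ * x) / (2 * v) by
          field_simp]
        gcongr
        nlinarith [sq_nonneg x]
    _ = (Real.sqrt (2 * Real.pi * v))⁻¹ * Real.exp (-μ ^ 2 / (2 * v)) * (v / μ) := by
        rw [integral_const_mul, integral_exp_mul_Iic ha]
        simp
    _ ≤ (Real.sqrt v)⁻¹ * Real.exp (-μ ^ 2 / (2 * v)) * (v / μ) := by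
        gcongr
        nlinarith [Real.pi_gt_three]
    _ = _ := by
        nth_rewrite 3 [← Real.mul_self_sqrt hv'.le]
        field_simp

/-! ### Sums of received symbols -/

theorem modulate_zero : modulate 0 = 1 := by
  simp [modulate]

theorem modulate_one : modulate 1 = -1 := by
  have : (1 : ZMod 2).val = 1 := rfl
  rw [modulate, this]
  norm_num

theorem eq_zero_or_one (b : ZMod 2) : b = 0 ∨ b = 1 := by
  revert b
  decide

theorem modulate_mul_self (b : ZMod 2) : modulate b * modulate b = 1 := by
  rcases eq_zero_or_one b with rfl | rfl <;> simp [modulate_zero, modulate_one]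

instance {n : ℕ} (σ : ℝ) (c : Fin n → ZMod 2) : IsProbabilityMeasure (awgnOutput σ c) := by
  unfold awgnOutput
  infer_instance

/-- The correlation of the received vector with the codeword on a set of positions is Gaussian. -/
theorem map_sum_awgnOutput {n : ℕ} (σ : ℝ) (c : Fin n → ZMod 2) (I : Finset (Fin n)) :
    (awgnOutput σ c).map (fun y => ∑ i ∈ I, modulate (c i) * y i) =
      gaussianReal I.card (I.card * (σ ^ 2).toNNReal) := by
  have hmeas : ∀ i, Measurable fun y : Fin n → ℝ => modulate (c i) * y i := fun i => by fun_prop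
  have hind : iIndepFun (fun i (y : Fin n → ℝ) => modulate (c i) * y i) (awgnOutput σ c) :=
    iIndepFun_pi (X := fun i x => modulate (c i) * x) fun i => by fun_prop
  have hlaw : ∀ i, (awgnOutput σ c).map (fun y => modulate (c i) * y i) =
      gaussianReal 1 (σ ^ 2).toNNReal := by
    intro i
    have h1 : (awgnOutput σ c).map (fun y => y i) =
        gaussianReal (modulate (c i)) (σ ^ 2).toNNReal :=
      (measurePreserving_eval (fun i => gaussianReal (modulate (c i)) (σ ^ 2).toNNReal) i).map_eq
    have h2 : (fun y : Fin n → ℝ => modulate (c i) * y i) =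
        (fun x => modulate (c i) * x) ∘ fun y => y i := rfl
    rw [h2, ← Measure.map_map (by fun_prop) (by fun_prop), h1, gaussianReal_map_const_mul]
    congr 1
    · exact modulate_mul_self _
    · ext
      simp [sq, modulate_mul_self]
  induction I using Finset.induction_on with
  | empty => simp [gaussianReal_zero_var]
  | insert i I hi ih =>
    have hind' : IndepFun (fun y : Fin n → ℝ => modulate (c i) * y i)
        (fun y => ∑ j ∈ I, modulate (c j) * y j) (awgnOutput σ c) := by
      have := (hind.indepFun_finsetSum_of_notMem hmeas hi).symm
      convert this using 1
      ext y
      simp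
    have := gaussianReal_add_gaussianReal_of_indepFun hind' (hlaw i) ih
    rw [Finset.card_insert_of_notMem hi]
    convert this using 2
    · ext y
      simp [Finset.sum_insert hi]
    · push_cast; ring
    · push_cast; ring

theorem awgnOutput_sum_nonpos_le {n : ℕ} {σ : ℝ} (hσ : 0 < σ) (c : Fin n → ZMod 2)
    {I : Finset (Fin n)} (hI : I.Nonempty) :
    (awgnOutput σ c).real {y | ∑ i ∈ I, modulate (c i) * y i ≤ 0} ≤
      σ * Real.sqrt (1 / I.card) * Real.exp (-(1 / (2 * σ ^ 2)) * I.card) := by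
  have hc : (0 : ℝ) < I.card := by exact_mod_cast hI.card_pos
  have h1 : (awgnOutput σ c).real {y | ∑ i ∈ I, modulate (c i) * y i ≤ 0} =
      (gaussianReal I.card (I.card * (σ ^ 2).toNNReal)).real (Set.Iic 0) := by
    rw [← map_sum_awgnOutput σ c I, map_measureReal_apply (by fun_prop) measurableSet_Iic]
    rfl
  have hv : ((I.card * (σ ^ 2).toNNReal : NNReal) : ℝ) = I.card * σ ^ 2 := by
    push_cast
    rw [Real.coe_toNNReal _ (sq_nonneg σ)]
  rw [h1]
  refine (gaussianReal_real_Iic_zero_le hc ?_).trans (le_of_eq ?_)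
  · intro h0
    rw [← NNReal.coe_eq_zero, hv] at h0
    have : 0 < I.card * σ ^ 2 := by positivity
    exact this.ne' h0
  · rw [hv, Real.sqrt_mul hc.le, Real.sqrt_sq hσ.le]
    congr 1
    · rw [Real.sqrt_div zero_le_one, Real.sqrt_one]
      have := Real.mul_self_sqrt hc.le
      have hs : 0 < Real.sqrt I.card := Real.sqrt_pos.2 hc
      field_simp
      nlinarith
    · congr 1
      field_simp

theorem awgnLLR_eq {σ : ℝ} (hσ : 0 < σ) (y : ℝ) : awgnLLR σ y = 2 / σ ^ 2 * y := by
  have hv : (((σ ^ 2).toNNReal : NNReal) : ℝ) = σ ^ 2 := Real.coe_toNNReal _ (sq_nonneg σ)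
  have hpos : 0 < (Real.sqrt (2 * Real.pi * σ ^ 2))⁻¹ := by positivity
  rw [awgnLLR, gaussianPDFReal, gaussianPDFReal, hv, modulate_zero, modulate_one,
    mul_div_mul_left _ _ hpos.ne', ← Real.exp_sub, Real.log_exp]
  field_simp
  ring

/-! ### Feasible points of RALP relative to a codeword -/

section Trellis

variable {n : ℕ} (f : TrellisEdge n → ℝ)

theorem outFlow_castSucc (v : Fin n) (a : ZMod 2) :
    outFlow f (v.castSucc, a) = ∑ b, f (v, a, b) := by
  refine Finset.sum_nbij' (fun e => e.2.2) (fun b => (v, a, b)) ?_ ?_ ?_ ?_ ?_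
  · simp
  · simp [source]
  · rintro ⟨i, a', b⟩ he
    simp only [source, Finset.mem_filter, Finset.mem_univ, true_and, Prod.mk.injEq,
      Fin.castSucc_inj] at he
    simp [he.1, he.2]
  · simp
  · rintro ⟨i, a', b⟩ he
    simp only [source, Finset.mem_filter, Finset.mem_univ, true_and, Prod.mk.injEq,
      Fin.castSucc_inj] at he
    simp [he.1, he.2]

theorem inFlow_succ (v : Fin n) (b : ZMod 2) : inFlow f (v.succ, b) = ∑ a, f (v, a, b) := by
  refine Finset.sum_nbij' (fun e => e.2.1) (fun a => (v, a, b)) ?_ ?_ ?_ ?_ ?_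
  · simp
  · simp [target]
  · rintro ⟨i, a', b'⟩ he
    simp only [target, Finset.mem_filter, Finset.mem_univ, true_and, Prod.mk.injEq,
      Fin.succ_inj] at he
    simp [he.1, he.2]
  · simp
  · rintro ⟨i, a', b'⟩ he
    simp only [target, Finset.mem_filter, Finset.mem_univ, true_and, Prod.mk.injEq,
      Fin.succ_inj] at he
    simp [he.1, he.2]

theorem inFlow_zero (a : ZMod 2) : inFlow f (0, a) = 0 :=
  Finset.sum_eq_zero fun e he => by
    simp [target, Fin.succ_ne_zero] at he

theorem outFlow_last (a : ZMod 2) : outFlow f (Fin.last n, a) = 0 :=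
  Finset.sum_eq_zero fun e he => by
    simp [source, Fin.castSucc_ne_last] at he

theorem sum_zmod_two (g : ZMod 2 → ℝ) (a : ZMod 2) : ∑ b, g b = g a + g (a + 1) := by
  have h : ∑ b, g b = g 0 + g 1 := Fin.sum_univ_two g
  rcases eq_zero_or_one a with rfl | rfl
  · simpa using h
  · rw [h, add_comm]
    rfl

theorem cyclicSucc_last {v w : Fin n} (hv : v.val + 1 = n) (hw : w.val = 0) :
    cyclicSucc n v = w := by
  cases n with
  | zero => exact v.elim0
  | succ n =>
    have h1 : v = Fin.last n := Fin.ext (by simpa using hv)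
    have h2 : w = 0 := Fin.ext hw
    rw [cyclicSucc, h1, h2, finRotate_last]

end Trellis

section Codeword

variable {k q : ℕ} {π : Interleaver k q}

theorem card_divNat_eq (π : Interleaver k q) (t : Fin k) :
    (Finset.univ.filter fun i => (π i).divNat = t).card = q := by
  have h1 : (Finset.univ.filter fun i => (π i).divNat = t).card =
      (Finset.univ.filter fun x : Fin k × Fin q => x.1 = t).card := by
    refine Finset.card_equiv (π.trans finProdFinEquiv.symm) fun i => ?_
    simp
  have h2 : (Finset.univ.filter fun x : Fin k × Fin q => x.1 = t) = {t} ×ˢ Finset.univ := by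
    ext x
    simp only [Finset.mem_filter, Finset.mem_univ, true_and, Finset.mem_product,
      Finset.mem_singleton, and_true]
  rw [h1, h2]
  simp

theorem sum_repetition_eq_zero (hq : Even q) (u : Fin k → ZMod 2) :
    ∑ i, repetition u (π i) = 0 := by
  rw [Equiv.sum_comp π (repetition u), ← Equiv.sum_comp finProdFinEquiv, Fintype.sum_prod_type]
  refine Finset.sum_eq_zero fun t _ => ?_
  have : ∀ r : Fin q, repetition u (finProdFinEquiv (t, r)) = u t := fun r =>
    congrArg u (congrArg Prod.fst (finProdFinEquiv.symm_apply_apply (t, r)))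
  simp only [this, Finset.sum_const, Finset.card_univ, Fintype.card_fin, nsmul_eq_mul]
  rw [(ZMod.natCast_eq_zero_iff q 2).2 hq.two_dvd, zero_mul]

theorem encode_eq_zero_of_last (hq : Even q) (u : Fin k → ZMod 2) {v : Fin (k * q)}
    (hv : v.val + 1 = k * q) : encode π u v = 0 := by
  rw [encode, accumulate, ← sum_repetition_eq_zero (π := π) hq u]
  congr 1
  ext j
  simp only [Finset.mem_Iic, Finset.mem_univ, iff_true, Fin.le_def]
  omega

/-- The trellis is terminated: the state before the first layer is the state after the last. -/
theorem encode_cyclicSucc (hq : Even q) (u : Fin k → ZMod 2) (v : Fin (k * q)) :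
    encode π u (cyclicSucc _ v) = encode π u v + u (π (cyclicSucc _ v)).divNat := by
  by_cases hv : v.val + 1 < k * q
  · have hs := val_cyclicSucc v hv
    have : Finset.Iic (cyclicSucc _ v) = insert (cyclicSucc _ v) (Finset.Iic v) := by
      ext j
      simp only [Finset.mem_Iic, Finset.mem_insert, Fin.le_def, Fin.ext_iff]
      omega
    rw [encode, accumulate, accumulate, this, Finset.sum_insert, add_comm]
    · rfl
    · simp only [Finset.mem_Iic, Fin.le_def]
      omega
  · have hv' : v.val + 1 = k * q := by omega
    rw [encode_eq_zero_of_last hq u hv', zero_add]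
    have h0 : cyclicSucc _ v = ⟨0, by omega⟩ := cyclicSucc_last hv' rfl
    rw [h0, encode, accumulate]
    have : Finset.Iic (⟨0, by omega⟩ : Fin (k * q)) = {⟨0, by omega⟩} := by
      ext j
      simp only [Finset.mem_Iic, Finset.mem_singleton, Fin.le_def, Fin.ext_iff]
      omega
    rw [this, Finset.sum_singleton]
    rfl

/-- The state of the encoder before layer `v`. -/
def prevState (π : Interleaver k q) (u : Fin k → ZMod 2) (v : Fin (k * q)) : ZMod 2 :=
  encode π u ((cyclicSucc _).symm v)

theorem prevState_cyclicSucc (u : Fin k → ZMod 2) (v : Fin (k * q)) :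
    prevState π u (cyclicSucc _ v) = encode π u v := by
  simp [prevState]

theorem encode_eq_prevState (hq : Even q) (u : Fin k → ZMod 2) (v : Fin (k * q)) :
    encode π u v = prevState π u v + u (π v).divNat := by
  simpa [prevState] using encode_cyclicSucc (π := π) hq u ((cyclicSucc _).symm v)

theorem prevState_of_val_eq_zero (hq : Even q) (u : Fin k → ZMod 2) {v : Fin (k * q)}
    (hv : v.val = 0) : prevState π u v = 0 := by
  have hpos : 0 < k * q := v.pos
  have : (cyclicSucc _).symm v = ⟨k * q - 1, by omega⟩ := by
    rw [Equiv.symm_apply_eq]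
    exact (cyclicSucc_last (by simp only; omega) hv).symm
  rw [prevState, this]
  exact encode_eq_zero_of_last hq u (by simp only; omega)

/-- The flow along the path of a codeword. -/
def codewordPoint (π : Interleaver k q) (u : Fin k → ZMod 2) : RALPPoint k q :=
  (fun e => if e.2.1 = prevState π u e.1 ∧ e.2.2 = encode π u e.1 then 1 else 0,
    fun t => ((u t).val : ℝ))

theorem sum_codewordPoint_right (u : Fin k → ZMod 2) (v : Fin (k * q)) (a : ZMod 2) :
    ∑ b, (codewordPoint π u).1 (v, a, b) = if a = prevState π u v then 1 else 0 := by
  by_cases h : a = prevState π u v <;> simp [codewordPoint, h]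

theorem sum_codewordPoint_left (u : Fin k → ZMod 2) (v : Fin (k * q)) (b : ZMod 2) :
    ∑ a, (codewordPoint π u).1 (v, a, b) = if b = encode π u v then 1 else 0 := by
  by_cases h : b = encode π u v <;> simp [codewordPoint, h]

theorem isFeasible_codewordPoint (hq : Even q) (hn : 0 < k * q) (u : Fin k → ZMod 2) :
    IsFeasible π (codewordPoint π u) where
  unit_flow := by
    have : (0 : Fin (k * q + 1)) = Fin.castSucc ⟨0, hn⟩ := rfl
    rw [this, outFlow_castSucc, sum_codewordPoint_right, prevState_of_val_eq_zero hq u rfl,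
      if_pos rfl]
  conservation := by
    rintro ⟨j, a⟩ h0 hlast
    rcases Fin.eq_zero_or_eq_succ j with rfl | ⟨v, rfl⟩
    · have : (0 : Fin (k * q + 1)) = Fin.castSucc ⟨0, hn⟩ := rfl
      rw [inFlow_zero, this, outFlow_castSucc, sum_codewordPoint_right,
        prevState_of_val_eq_zero hq u rfl, if_neg]
      rintro rfl
      exact h0 rfl
    · rw [inFlow_succ, sum_codewordPoint_left]
      by_cases hv : v.val + 1 < k * q
      · have : v.succ = (cyclicSucc _ v).castSucc := Fin.ext (val_cyclicSucc v hv).symm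
        rw [this, outFlow_castSucc, sum_codewordPoint_right, prevState_cyclicSucc]
      · have hv' : v.val + 1 = k * q := by omega
        have : v.succ = Fin.last (k * q) := Fin.ext hv'
        rw [this] at hlast ⊢
        rw [outFlow_last, encode_eq_zero_of_last hq u hv', if_neg]
        rintro rfl
        exact hlast rfl
  agreeability := by
    intro t i hi
    simp only [copies, Finset.mem_filter, Finset.mem_univ, true_and] at hi
    have hc := encode_eq_prevState (π := π) hq u i
    rw [hi] at hc
    rw [inputOneEdges, Finset.sum_pair (by simp)]
    simp only [codewordPoint, hc]
    have h1 : (1 : ZMod 2).val = 1 := rfl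
    rcases eq_zero_or_one (u t) with h | h <;>
      rcases eq_zero_or_one (prevState π u i) with h' | h' <;> rw [h, h'] <;>
      simp [h1, show (1 : ZMod 2) + 1 = 0 from rfl]
  nonneg := fun e => by
    simp only [codewordPoint]
    split_ifs <;> norm_num
  le_one := fun e => by
    simp only [codewordPoint]
    split_ifs <;> norm_num

theorem objective_eq (γ : Fin (k * q) → ℝ) (P : RALPPoint k q) :
    objective γ P = ∑ v, γ v * ∑ a, P.1 (v, a, 1) := by
  rw [objective, Fintype.sum_prod_type]
  refine Finset.sum_congr rfl fun v _ => ?_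
  rw [Fintype.sum_prod_type, Finset.mul_sum]
  refine Finset.sum_congr rfl fun a _ => ?_
  rw [sum_zmod_two _ 1]
  simp [edgeCost, show (1 : ZMod 2) + 1 = 0 from rfl]

variable {P : RALPPoint k q}

theorem IsFeasible.conservation_cyclicSucc (hP : IsFeasible π P) {v : Fin (k * q)}
    (hv : v.val + 1 < k * q) (a : ZMod 2) :
    ∑ b, P.1 (cyclicSucc _ v, a, b) = ∑ b, P.1 (v, b, a) := by
  have h : v.succ = (cyclicSucc _ v).castSucc := Fin.ext (val_cyclicSucc v hv).symm
  rw [← outFlow_castSucc, ← inFlow_succ, ← h]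
  refine hP.conservation _ (fun h0 => ?_) fun h0 => ?_
  · exact Fin.succ_ne_zero v (congrArg Prod.fst h0)
  · have := congrArg (fun x : TrellisNode (k * q) => x.1.val) h0
    simp at this
    omega

theorem IsFeasible.layer_flow (hP : IsFeasible π P) (v : Fin (k * q)) :
    ∑ a, ∑ b, P.1 (v, a, b) = 1 := by
  obtain ⟨m, hm⟩ := v
  induction m with
  | zero =>
    have h1 : (0 : Fin (k * q + 1)) = Fin.castSucc ⟨0, hm⟩ := rfl
    have h2 := hP.unit_flow
    have h4 := hP.conservation (0, 1) (by simp) (by simp)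
    rw [inFlow_zero] at h4
    rw [h1, outFlow_castSucc] at h2 h4
    rw [sum_zmod_two _ 0, h2, zero_add, h4, add_zero]
  | succ m ih =>
    have h := fun a => hP.conservation_cyclicSucc (v := ⟨m, by omega⟩) hm a
    have h1 : cyclicSucc _ (⟨m, by omega⟩ : Fin (k * q)) = ⟨m + 1, hm⟩ :=
      Fin.ext (val_cyclicSucc _ hm)
    rw [h1] at h
    rw [Finset.sum_congr rfl fun a _ => h a, Finset.sum_comm]
    exact ih _

/-- The closing edge is no exception: the wrong state there is `1`, which no flow can leave at the
last time or enter at time 0, so both sides vanish. -/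
theorem IsFeasible.conservation_wrong (hq : Even q) (hP : IsFeasible π P) (u : Fin k → ZMod 2)
    (v : Fin (k * q)) : ∑ b, P.1 (cyclicSucc _ v, encode π u v + 1, b) =
      ∑ a, P.1 (v, a, encode π u v + 1) := by
  by_cases hv : v.val + 1 < k * q
  · exact hP.conservation_cyclicSucc hv _
  · have hv' : v.val + 1 = k * q := by omega
    have h1 : v.succ = Fin.last (k * q) := Fin.ext hv'
    have h2 : (cyclicSucc _ v).castSucc = 0 := by
      rw [cyclicSucc_last hv' (w := ⟨0, by omega⟩) rfl]
      rfl
    rw [encode_eq_zero_of_last hq u hv', zero_add, ← outFlow_castSucc, ← inFlow_succ, h1, h2,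
      ← hP.conservation (Fin.last _, 1) (by simp) (by simp), outFlow_last,
      hP.conservation (0, 1) (by simp) (by simp), inFlow_zero]

/-- The flow that passes through the wrong state after layer `v`. -/
def wrongFlow (π : Interleaver k q) (u : Fin k → ZMod 2) (P : RALPPoint k q)
    (v : Fin (k * q)) : ℝ :=
  ∑ a, P.1 (v, a, encode π u v + 1)

theorem IsFeasible.wrongFlow_eq_zero_of_last (hq : Even q) (hP : IsFeasible π P)
    (u : Fin k → ZMod 2) {v : Fin (k * q)} (hv : v.val + 1 = k * q) :
    wrongFlow π u P v = 0 := by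
  have h1 : v.succ = Fin.last (k * q) := Fin.ext hv
  rw [wrongFlow, encode_eq_zero_of_last hq u hv, zero_add, ← inFlow_succ, h1,
    ← hP.conservation (Fin.last _, 1) (by simp) (by simp), outFlow_last]

/-- The deviation of the information bit `t`. -/
def wrongBit (u : Fin k → ZMod 2) (P : RALPPoint k q) (t : Fin k) : ℝ :=
  if u t = 0 then P.2 t else 1 - P.2 t

/-- The edges that switch between right and wrong states are those whose input differs from the
transmitted bit. Agreeability makes their flow the same at all copies of the bit. -/
theorem IsFeasible.wrongBit_eq (hq : Even q) (hP : IsFeasible π P) (u : Fin k → ZMod 2)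
    (v : Fin (k * q)) :
    P.1 (v, prevState π u v + 1, encode π u v) + P.1 (v, prevState π u v, encode π u v + 1) =
      wrongBit u P (π v).divNat := by
  have hx := hP.agreeability (π v).divNat v (by simp [copies])
  have ht := hP.layer_flow v
  rw [inputOneEdges, Finset.sum_pair (by simp)] at hx
  rw [sum_zmod_two _ 0, sum_zmod_two _ 0, sum_zmod_two _ 0, zero_add] at ht
  rw [wrongBit, encode_eq_prevState hq, hx]
  have h2 : (1 : ZMod 2) + 1 = 0 := rfl
  rcases eq_zero_or_one (u (π v).divNat) with h | h <;>
    rcases eq_zero_or_one (prevState π u v) with h' | h' <;>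
    simp only [h, h', h2, zero_add, add_zero, if_true, one_ne_zero, if_false] <;> linarith

theorem objective_sub (hP : IsFeasible π P) (u : Fin k → ZMod 2) (γ : Fin (k * q) → ℝ) :
    objective γ P - objective γ (codewordPoint π u) =
      ∑ v, wrongFlow π u P v * (modulate (encode π u v) * γ v) := by
  rw [objective_eq, objective_eq, ← Finset.sum_sub_distrib]
  refine Finset.sum_congr rfl fun v _ => ?_
  rw [sum_codewordPoint_left, wrongFlow]
  have ht := hP.layer_flow v
  rw [Finset.sum_comm, sum_zmod_two _ 0] at ht
  rcases eq_zero_or_one (encode π u v) with h | h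
  · rw [h, modulate_zero, if_neg one_ne_zero, zero_add]
    ring
  · rw [h, modulate_one, if_pos rfl, show (1 : ZMod 2) + 1 = 0 from rfl]
    rw [zero_add] at ht
    linear_combination γ v * ht

/-- If no flow passes through a wrong state, then the decoder succeeds. -/
theorem IsFeasible.decoderOutput_eq (hq : Even q) (hq2 : 2 ≤ q) (hP : IsFeasible π P)
    (u : Fin k → ZMod 2) (h : ∀ v, wrongFlow π u P v = 0) :
    decoderOutput P = some fun t => ((u t).val : ℝ) := by
  have h1 : ∀ v a, P.1 (v, a, encode π u v + 1) = 0 := fun v a =>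
    (Finset.sum_eq_zero_iff_of_nonneg fun a _ => hP.nonneg _).1 (h v) a (Finset.mem_univ a)
  have h2 : ∀ v b, P.1 (v, prevState π u v + 1, b) = 0 := by
    intro v b
    have := hP.conservation_wrong hq u ((cyclicSucc _).symm v)
    rw [show ∑ a, P.1 ((cyclicSucc _).symm v, a, encode π u ((cyclicSucc _).symm v) + 1) = 0 from
      h _, Equiv.apply_symm_apply] at this
    exact (Finset.sum_eq_zero_iff_of_nonneg fun a _ => hP.nonneg _).1 this b (Finset.mem_univ b)
  have h3 : ∀ v, P.1 (v, prevState π u v, encode π u v) = 1 := by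
    intro v
    have := hP.layer_flow v
    rwa [sum_zmod_two _ (prevState π u v), sum_zmod_two _ (encode π u v), h1,
      Finset.sum_eq_zero fun b _ => h2 v b, add_zero, add_zero] at this
  have hint : ∀ e, P.1 e = 0 ∨ P.1 e = 1 := by
    rintro ⟨v, a, b⟩
    have hcase : ∀ x y : ZMod 2, x = y ∨ x = y + 1 := by decide
    rcases hcase a (prevState π u v) with rfl | rfl
    · rcases hcase b (encode π u v) with rfl | rfl
      · exact Or.inr (h3 v)
      · exact Or.inl (h1 v _)
    · exact Or.inl (h2 v _)
  rw [decoderOutput, if_pos hint]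
  congr 1
  funext t
  obtain ⟨v, hv⟩ : ∃ v, (π v).divNat = t := by
    have : (Finset.univ.filter fun i => (π i).divNat = t).Nonempty := by
      rw [← Finset.card_pos, card_divNat_eq]
      omega
    obtain ⟨v, hv⟩ := this
    exact ⟨v, by simpa using hv⟩
  have hb := hP.wrongBit_eq hq u v
  rw [h1, h2, hv, wrongBit] at hb
  have hone : (1 : ZMod 2).val = 1 := rfl
  rcases eq_zero_or_one (u t) with h0 | h0
  · rw [if_pos h0] at hb
    rw [h0, ZMod.val_zero]
    simpa using hb.symm
  · rw [if_neg (by rw [h0]; exact one_ne_zero)] at hb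
    rw [h0, hone]
    push_cast
    linarith

/-- If the decoder fails, then there are walks of every length along which the received word is
negatively correlated with the transmitted codeword. -/
theorem IsOptimal.exists_walk (hq : Even q) (hq2 : 2 ≤ q) (hn : 0 < k * q)
    {γ : Fin (k * q) → ℝ} (hP : IsOptimal π γ P) {u : Fin k → ZMod 2}
    (hfail : decoderOutput P ≠ some fun t => ((u t).val : ℝ)) (h : ℕ) :
    ∃ s l, l.length = h ∧
      (s :: l).IsChain (fun s t => Dart.Follows (fun i => (π i).divNat) s.back t) ∧
      (∀ t ∈ s :: l, t.edge.val + 1 < k * q) ∧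
      ((s :: l).map fun t => modulate (encode π u t.edge) * γ t.edge).sum ≤ 0 := by
  have hnn : ∀ v, 0 ≤ wrongFlow π u P v := fun v => Finset.sum_nonneg fun a _ => hP.1.nonneg _
  have hpos : ∃ v, 0 < wrongFlow π u P v := by
    by_contra! hcon
    exact hfail (hP.1.decoderOutput_eq hq hq2 u fun v => le_antisymm (hcon v) (hnn v))
  have hcost := hP.2 _ (isFeasible_codewordPoint hq hn u)
  rw [← sub_nonpos, objective_sub hP.1] at hcost
  -- At each layer, `α` stays off the codeword path, `β` returns to it and `κ` leaves it.
  obtain ⟨s, l, h1, h2, h3, h4⟩ := exists_walk_of_flow hq2 (card_divNat_eq π)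
    (α := fun v => P.1 (v, prevState π u v + 1, encode π u v + 1))
    (β := fun v => P.1 (v, prevState π u v + 1, encode π u v))
    (κ := fun v => P.1 (v, prevState π u v, encode π u v + 1))
    (fun _ => hP.1.nonneg _) (fun _ => hP.1.nonneg _) (fun _ => hP.1.nonneg _)
    (hP.1.wrongBit_eq hq u)
    (fun v => by rw [wrongFlow, sum_zmod_two _ (prevState π u v), add_comm])
    (fun v => by
      rw [wrongFlow, ← hP.1.conservation_wrong hq u v,
        sum_zmod_two _ (encode π u (cyclicSucc _ v)), prevState_cyclicSucc, add_comm])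
    hpos hcost h
  -- The closing edge carries no wrong flow, so the walk stays on the Hamiltonian path of the
  -- auxiliary graph.
  refine ⟨s, l, h1, h2, fun t ht => ?_, h4⟩
  have := h3 t ht
  by_contra hcon
  exact this.ne' (hP.1.wrongFlow_eq_zero_of_last hq u (by omega))

end Codeword

/-! ### The union bound -/

theorem wordErrorProb_le {k q : ℕ} (hq : Even q) (hq2 : 2 ≤ q) (hn : 0 < k * q) {σ : ℝ}
    (hσ : 0 < σ) {π : Interleaver k q} {g : ℕ} (hg : (g : ℕ∞) ≤ girth π)
    {solve : (Fin (k * q) → ℝ) → RALPPoint k q} (hsolve : SolvesRALP σ π solve)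
    (u : Fin k → ZMod 2) {h : ℕ} (hh : 2 * (h + 1) ≤ g) :
    wordErrorProb σ π solve u ≤ (2 * (k * q) * (2 * q - 1) ^ h : ℕ) *
      (σ * Real.sqrt (1 / (h + 1 : ℕ)) * Real.exp (-(1 / (2 * σ ^ 2)) * (h + 1 : ℕ))) := by
  classical
  set c := encode π u
  set lab : Fin (k * q) → Fin k := fun i => (π i).divNat
  set W : Finset (List (Dart (k * q))) := (Finset.univ.biUnion fun s => Dart.walks lab h s).filter
    fun l => l.length = h + 1 ∧ (l.map Dart.edge).Nodup with hW
  set E : List (Dart (k * q)) → Set (Fin (k * q) → ℝ) := fun l =>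
    {y | ∑ i ∈ (l.map Dart.edge).toFinset, modulate (c i) * y i ≤ 0}
  have hsub : {y | decoderOutput (solve y) ≠ some fun t => ((u t).val : ℝ)} ⊆ ⋃ l ∈ W, E l := by
    intro y hy
    obtain ⟨s, l, h1, h2, h3, h4⟩ := (hsolve y).exists_walk hq hq2 hn hy h
    have hnodup := nodup_edges_of_chain h2 h3 hg (by rw [List.length_cons, h1]; exact hh)
    refine Set.mem_biUnion (x := s :: l) ?_ ?_
    · rw [hW, Finset.mem_coe, Finset.mem_filter]
      refine ⟨Finset.mem_biUnion.2 ⟨s, Finset.mem_univ _, h1 ▸ Dart.mem_walks h2⟩, ?_, hnodup⟩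
      rw [List.length_cons, h1]
    · have hpos : 0 < 2 / σ ^ 2 := by positivity
      have hsum : ((s :: l).map fun t => modulate (c t.edge) * awgnLLR σ (y t.edge)).sum =
          2 / σ ^ 2 * ∑ i ∈ ((s :: l).map Dart.edge).toFinset, modulate (c i) * y i := by
        rw [List.sum_toFinset _ hnodup, List.map_map, ← List.sum_map_mul_left]
        congr 1
        refine List.map_congr_left fun t _ => ?_
        rw [awgnLLR_eq hσ, Function.comp_apply]
        ring
      rw [hsum] at h4
      exact nonpos_of_mul_nonpos_right h4 hpos
  have hbound : ∀ l ∈ W, (awgnOutput σ c).real (E l) ≤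
      σ * Real.sqrt (1 / (h + 1 : ℕ)) * Real.exp (-(1 / (2 * σ ^ 2)) * (h + 1 : ℕ)) := by
    intro l hl
    obtain ⟨-, hlen, hnd⟩ := Finset.mem_filter.1 hl
    have hcard : (l.map Dart.edge).toFinset.card = h + 1 := by
      rw [List.toFinset_card_of_nodup hnd, List.length_map, hlen]
    have := awgnOutput_sum_nonpos_le hσ c (I := (l.map Dart.edge).toFinset)
      (Finset.card_pos.1 (by omega))
    rwa [hcard] at this
  have hcardW : W.card ≤ 2 * (k * q) * (2 * q - 1) ^ h := by
    refine (Finset.card_filter_le _ _).trans ((Finset.card_biUnion_le_card_mul _ _ _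
      fun s _ => Dart.card_walks_le (by omega) (card_divNat_eq π) h s).trans (le_of_eq ?_))
    simp only [Finset.card_univ, Fintype.card_prod, Fintype.card_fin, Fintype.card_bool]
    ring
  -- Monotonicity does not need the failure set to be measurable, so any tie-breaking rule is
  -- allowed.
  calc wordErrorProb σ π solve u ≤ (awgnOutput σ c).real (⋃ l ∈ W, E l) :=
        measureReal_mono hsub (measure_ne_top _ _)
    _ ≤ ∑ l ∈ W, (awgnOutput σ c).real (E l) := measureReal_biUnion_finset_le _ _
    _ ≤ W.card • (σ * Real.sqrt (1 / (h + 1 : ℕ)) *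
          Real.exp (-(1 / (2 * σ ^ 2)) * (h + 1 : ℕ))) := Finset.sum_le_card_nsmul _ _ _ hbound
    _ ≤ _ := by
        rw [nsmul_eq_mul]
        gcongr

/-- The estimate of the union bound for walks of half the guaranteed girth. -/
theorem union_bound_lt {σ : ℝ} (hσ : 0 < σ) {q n : ℕ} (hq : 2 ≤ q) (hn : q ^ 4 ≤ n) {ε : ℝ}
    (hε : 0 < ε)
    (hsnr : 1 / σ ^ 2 > 4 * Real.log q * (1 + ε + 1 / 2 * Real.logb q (2 * q - 1)))
    {h : ℕ} (hh : Nat.log q n ≤ 2 * h + 4) :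
    (2 * n * (2 * q - 1) ^ h : ℕ) *
        (σ * Real.sqrt (1 / (h + 1 : ℕ)) * Real.exp (-(1 / (2 * σ ^ 2)) * (h + 1 : ℕ))) <
      (6 * σ * Real.exp (3 / (4 * σ ^ 2))) * Real.sqrt (1 / (Real.logb q n - 1)) *
        (n : ℝ) ^ (-ε) := by
  have hq1 : (1 : ℝ) < q := by exact_mod_cast (show 1 < q by omega)
  have hq2 : (2 : ℝ) ≤ q := by exact_mod_cast hq
  have hlogq : 0 < Real.log q := Real.log_pos hq1
  have hn0 : 0 < n := lt_of_lt_of_le (by positivity) hn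
  have hnR : (0 : ℝ) < n := by exact_mod_cast hn0
  set L := Real.logb q n with hL
  have hLlog : L * Real.log q = Real.log n := by
    rw [hL, Real.logb, div_mul_cancel₀ _ hlogq.ne']
  have hL4 : 4 ≤ L := by
    rw [hL, Real.le_logb_iff_rpow_le hq1 hnR]
    exact_mod_cast hn
  have hLh : L < 2 * (h : ℝ) + 5 := by
    rw [hL, Real.logb_lt_iff_lt_rpow hq1 hnR]
    have h1 : n < q ^ (2 * h + 5) :=
      (Nat.lt_pow_succ_log_self (by omega) n).trans_le (Nat.pow_le_pow_right (by omega) (by omega))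
    have h2 : (2 * (h : ℝ) + 5) = ((2 * h + 5 : ℕ) : ℝ) := by push_cast; ring
    rw [h2, Real.rpow_natCast]
    exact_mod_cast h1
  set B := 1 / (2 * σ ^ 2) with hB
  have hBpos : 0 < B := by positivity
  have hm : (0 : ℝ) < 2 * q - 1 := by linarith
  have hm1 : (1 : ℝ) ≤ 2 * q - 1 := by linarith
  set ℓ := Real.log (2 * q - 1) with hℓ
  have hℓ0 : 0 ≤ ℓ := Real.log_nonneg hm1
  have hBgt : 2 * Real.log q * (1 + ε) + ℓ < B := by
    have h1 : Real.log q * Real.logb q (2 * q - 1) = ℓ := by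
      rw [Real.logb, mul_div_cancel₀ _ hlogq.ne']
    have h2 : B = 1 / σ ^ 2 / 2 := by
      rw [hB]
      field_simp
    rw [h2]
    nlinarith
  have hcast : ((2 * n * (2 * q - 1) ^ h : ℕ) : ℝ) = 2 * n * Real.exp (ℓ * h) := by
    have h1 : ((2 * q - 1 : ℕ) : ℝ) = 2 * q - 1 := by
      rw [Nat.cast_sub (by omega)]
      push_cast
      ring
    rw [Nat.cast_mul, Nat.cast_pow, h1, mul_comm ℓ, Real.exp_nat_mul, Real.exp_log hm]
    push_cast
    ring
  have hexp : n * Real.exp (ℓ * h) * Real.exp (-B * (h + 1 : ℕ)) ≤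
      Real.exp (3 / (4 * σ ^ 2)) * (n : ℝ) ^ (-ε) := by
    rw [Real.rpow_def_of_pos hnR, ← hLlog]
    nth_rewrite 1 [← Real.exp_log hnR]
    rw [← hLlog, ← Real.exp_add, ← Real.exp_add, ← Real.exp_add, Real.exp_le_exp]
    have h3 : 3 / (4 * σ ^ 2) = 3 / 2 * B := by
      rw [hB]
      field_simp
      norm_num
    rw [h3]
    push_cast
    -- As `B - ℓ > 2 (1 + ε) log q`, the part `(B - ℓ) L / 2` of `(B - ℓ) (h + 1)` outweighs `(1 +
    -- ε) log n`. The deficit of up to `3 / 2` in `h + 1` against `L / 2` costs at most `3 / 2 * B`.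
    have hx : 0 ≤ (h : ℝ) + 1 - (L - 3) / 2 := by linarith
    nlinarith [mul_nonneg hx (sub_pos.2 hBgt).le, mul_nonneg hx hlogq.le,
      mul_nonneg hx (mul_pos hlogq hε).le, mul_nonneg (by linarith : 0 ≤ L - 3) (sub_pos.2 hBgt).le,
      mul_pos hlogq hε]
  have hsqrt : Real.sqrt (1 / (h + 1 : ℕ)) < 3 * Real.sqrt (1 / (L - 1)) := by
    have h9 : (3 : ℝ) = Real.sqrt 9 := by
      rw [show (9 : ℝ) = 3 ^ 2 by norm_num, Real.sqrt_sq (by norm_num)]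
    rw [h9, ← Real.sqrt_mul (by norm_num)]
    refine Real.sqrt_lt_sqrt (by positivity) ?_
    push_cast
    rw [mul_one_div, div_lt_div_iff₀ (by positivity) (by linarith)]
    have : (0 : ℝ) ≤ h := Nat.cast_nonneg h
    linarith
  have hpos : 0 < Real.exp (3 / (4 * σ ^ 2)) * (n : ℝ) ^ (-ε) := by positivity
  calc _ = 2 * σ * Real.sqrt (1 / (h + 1 : ℕ)) *
        (n * Real.exp (ℓ * h) * Real.exp (-B * (h + 1 : ℕ))) := by
        rw [hcast]
        ring
    _ ≤ 2 * σ * Real.sqrt (1 / (h + 1 : ℕ)) *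
        (Real.exp (3 / (4 * σ ^ 2)) * (n : ℝ) ^ (-ε)) := by gcongr
    _ < 2 * σ * (3 * Real.sqrt (1 / (L - 1))) *
        (Real.exp (3 / (4 * σ ^ 2)) * (n : ℝ) ^ (-ε)) := by gcongr
    _ = _ := by ring

end RepeatAccumulate

theorem theorem5 :
    -- Interleavers whose auxiliary graph has girth at least `⌊log_q n⌋ - 1` exist.
    (∀ q k : ℕ, Even q → 3 ≤ q → q ^ 4 ≤ k * q →
      ∃ π : Interleaver k q, ((Nat.log q (k * q) - 1 : ℕ) : ℕ∞) ≤ girth π) ∧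
    -- For every such interleaver, the word error probability is bounded as claimed.
    (∀ σ : ℝ, 0 < σ → ∃ K : ℝ, 0 < K ∧
      ∀ q k : ℕ, Even q → 2 ≤ q → q ^ 4 ≤ k * q →
      ∀ ε : ℝ, 0 < ε →
        1 / σ ^ 2 > 4 * Real.log q * (1 + ε + 1 / 2 * Real.logb q (2 * q - 1)) →
      ∀ π : Interleaver k q, ((Nat.log q (k * q) - 1 : ℕ) : ℕ∞) ≤ girth π →
      ∀ solve : (Fin (k * q) → ℝ) → RALPPoint k q, SolvesRALP σ π solve →
      ∀ u : Fin k → ZMod 2,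
        wordErrorProb σ π solve u <
          K * Real.sqrt (1 / (Real.logb q ((k * q : ℕ) : ℝ) - 1)) *
            ((k * q : ℕ) : ℝ) ^ (-ε)) := by
  refine ⟨fun q k heven hq hn => ?_, fun σ hσ =>
    -- The `6` is a factor 2 for the directions of the first edge times a factor 3 from comparing `h
    -- + 1` with `log_q n - 1`; the exponential pays for rounding `h`.
    ⟨6 * σ * Real.exp (3 / (4 * σ ^ 2)), by positivity,
      fun q k heven hq hn ε hε hsnr π hg solve hsolve u => ?_⟩⟩
  all_goals
    have hpos : 0 < k * q := lt_of_lt_of_le (by positivity) hn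
    have hlog : 4 ≤ Nat.log q (k * q) := Nat.le_log_of_pow_le (by omega) hn
  -- Evenness and `3 ≤ q` give the `4 ≤ q` that the ball count needs.
  · refine exists_interleaver_le_girth (by obtain ⟨r, rfl⟩ := heven; omega) (by omega) ?_
    exact (Nat.pow_le_pow_right (by omega) (Nat.sub_le _ _)).trans
      (Nat.pow_log_le_self q hpos.ne')
  · exact (wordErrorProb_le heven hq hpos hσ hg hsolve u
      -- This is the largest `h` with `2 (h + 1) ≤ ⌊log_q n⌋ - 1`; no subtraction truncates, because
      -- the logarithm is at least 4.
      (h := (Nat.log q (k * q) - 1) / 2 - 1) (by omega)).trans_lt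
      (union_bound_lt hσ hq hn hε hsnr (by omega))
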